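/- Work over $\mathbb C$. For a smooth projective toric variety $X$, let $S[X]=\mathbb C[\alpha_\rho]=\bigoplus_{D\in\operatorname{Pic}(X)}H^0(X,D)$ be its Cox ring (one variable for each ray $\rho$ of the fan, graded by $\operatorname{Pic}(X)$), and let $\widetilde S[X]=\mathbb C[x_\rho]=\bigoplus_D H^0(X,D)^*$ be the dual graded polynomial ring, with divided powers $x_\rho^{(d)}=x_\rho^d/d!$, on which $\alpha_\rho$ acts as $\partial/\partial x_\rho$; this action is denoted $\Theta\lrcorner F$. For $G\in\widetilde S[X]$ put $G^\perp=\{\Theta\in S[X]\mid\Theta\lrcorner G=0\}$, and write $G^\perp_D$ for its part of degree $D$. For a nonzero $F\in\widetilde S[X]$ homogeneous of degree $L\in\operatorname{Pic}(X)$, the border rank $\underline{\mathrm{br}}_X(F)$ is the least $r$ such that $[F]\in\mathbb P(H^0(X,L)^*)$ lies in the Zariski closure of the union of the linear spans $\langle p_1,\dots,p_r\rangle$ of $r$ points $p_i$ in the image of $X$ under the rational map to $\mathbb P(H^0(X,L)^*)$ given by the complete linear system $|L|$ (if $L$ is very ample, this image is $X$ embedded by $L$). **Theorem.** Let $a_0\ge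 a_1\ge a_2\ge 0$ be integers and $F=x_0^{(a_0)}x_1^{(a_1)}x_2^{(a_2)}\in\widetilde S[\mathbb P^2]=\mathbb C[x_0,x_1,x_2]$. (i) Let $Y$ be a smooth projective toric variety and $X=\mathbb P^2\times Y$, so that $\widetilde S[X]=\widetilde S[\mathbb P^2]\otimes\widetilde S[Y]$. Let $G\in\widetilde S[Y]$ be a (divided power) monomial and let $D\in\operatorname{Pic}(Y)$ be a degree such that $G^\perp_D=0$. Then $$\underline{\mathrm{br}}_{X}(F\cdot G)\ \ge\ (a_1+1)(a_2+1)\cdot\dim H^0(Y,D).$$ (ii) In particular, monomials in three variables attain the well-known upper bound: $\underline{\mathrm{br}}_{\mathbb P^2}(F)=(a_1+1)(a_2+1)$. -/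

import Mathlib

open scoped LinearAlgebra.Projectivization

noncomputable section

/-- A rational polyhedral simplicial fan in the lattice `κ → ℤ`, presented combinatorially: the
generators `ray ρ` of its rays, indexed by `ι`, and the sets of rays which span a cone of the fan.
(The axioms are in `FanData.IsSmoothProjective`.) -/
structure FanData (κ ι : Type*) where
  ray : ι → κ → ℤ
  cones : Set (Set ι)

namespace FanData

variable {κ ι κ' ι' : Type*} [Fintype κ] [Fintype ι] [Fintype κ'] [Fintype ι']

/-- The closed convex cone in `κ → ℝ` generated by the rays in `σ`. -/
def cone (X : FanData κ ι) (σ : Set ι) : Set (κ → ℝ) :=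
  {v | ∃ c : ι → ℝ, (∀ ρ, 0 ≤ c ρ) ∧ (∀ ρ, ρ ∉ σ → c ρ = 0) ∧
    ∀ k, v k = ∑ ρ, c ρ * (X.ray ρ k : ℝ)}

/-- The map sending a character `m` to the divisor `∑ ρ, ⟨m, u_ρ⟩ D_ρ`. -/
def divMap (X : FanData κ ι) : (κ → ℤ) →ₗ[ℤ] (ι → ℤ) :=
  Matrix.mulVecLin (Matrix.of X.ray)

/-- `X` is the fan of a smooth projective toric variety. -/
structure IsSmoothProjective (X : FanData κ ι) : Prop where
  /-- a face of a cone of the fan is in the fan -/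
  face_mem : ∀ σ ∈ X.cones, ∀ τ, τ ⊆ σ → τ ∈ X.cones
  /-- every `ρ : ι` is a ray of the fan -/
  ray_mem : ∀ ρ, {ρ} ∈ X.cones
  /-- two cones meet in their common face -/
  inter : ∀ σ ∈ X.cones, ∀ τ ∈ X.cones, X.cone σ ∩ X.cone τ = X.cone (σ ∩ τ)
  /-- the generators of each cone are part of a basis of the lattice -/
  smooth : ∀ σ ∈ X.cones, ∃ (b : Module.Basis κ ℤ (κ → ℤ)) (f : σ → κ),
    Function.Injective f ∧ ∀ ρ : σ, b (f ρ) = X.ray ρ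
  /-- the cones cover the whole space -/
  complete : ∀ v : κ → ℝ, ∃ σ ∈ X.cones, v ∈ X.cone σ
  /-- there is an ample divisor `∑ ρ, h ρ • D_ρ`, that is, one whose support function is
  strictly convex; `m` is the linear function on the full-dimensional cone `σ` -/
  projective : ∃ h : ι → ℤ, ∀ σ ∈ X.cones, σ.ncard = Fintype.card κ →
    ∃ m : κ → ℤ, (∀ ρ ∈ σ, X.divMap m ρ = - h ρ) ∧ ∀ ρ, ρ ∉ σ → - h ρ < X.divMap m ρ

/-- The fan of the projective plane, with rays `-e₁-e₂, e₁, e₂`. -/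
def projectivePlane : FanData (Fin 2) (Fin 3) where
  ray := ![![-1, -1], ![1, 0], ![0, 1]]
  cones := {σ | σ ≠ Set.univ}

/-- The fan of the product of two toric varieties. -/
def prod (X : FanData κ ι) (Y : FanData κ' ι') : FanData (κ ⊕ κ') (ι ⊕ ι') where
  ray := Sum.elim (fun i => Sum.elim (X.ray i) 0) (fun j => Sum.elim 0 (Y.ray j))
  cones := {σ | Sum.inl ⁻¹' σ ∈ X.cones ∧ Sum.inr ⁻¹' σ ∈ Y.cones}

/-- The divisor class group: torus invariant divisors modulo divisors of characters. It is the
Picard group when the toric variety is smooth. -/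
abbrev Pic (X : FanData κ ι) : Type _ := (ι → ℤ) ⧸ LinearMap.range X.divMap

open Classical in
/-- The degree of the variable of the Cox ring indexed by `ρ`: the class of the torus invariant
prime divisor `D_ρ`. -/
def varDegree (X : FanData κ ι) (ρ : ι) : X.Pic :=
  Submodule.Quotient.mk (Pi.single ρ 1)

/-- The graded piece of degree `D` of the Cox ring `ℂ[α_ρ : ρ ∈ ι]`, which is the space of
global sections `H⁰(X, D)`. -/
def sections (X : FanData κ ι) (D : X.Pic) : Submodule ℂ (MvPolynomial ι ℂ) :=
  MvPolynomial.weightedHomogeneousSubmodule ℂ X.varDegree D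

end FanData

section Apolarity

variable {ι : Type*} [Fintype ι]

/-- The divided power monomial `∏ ρ, x_ρ ^ (a_ρ) / a_ρ !` in the dual polynomial ring. -/
def dpMonomial (a : ι →₀ ℕ) : MvPolynomial ι ℂ :=
  MvPolynomial.monomial a (∏ ρ, ((a ρ).factorial : ℂ))⁻¹

/-- The apolarity action `Θ ⌟ F` of the Cox ring on the dual polynomial ring: `α_ρ` acts as the
partial derivative with respect to `x_ρ`. -/
def hook : MvPolynomial ι ℂ →ₗ[ℂ] MvPolynomial ι ℂ →ₗ[ℂ] MvPolynomial ι ℂ :=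
  (MvPolynomial.basisMonomials ι ℂ).constr ℂ fun s =>
    (MvPolynomial.basisMonomials ι ℂ).constr ℂ fun a =>
      MvPolynomial.monomial (a - s) (∏ ρ, ((a ρ).descFactorial (s ρ) : ℂ))

/-- On divided power monomials the action lowers the exponents, without coefficients. -/
theorem hook_dpMonomial (s a : ι →₀ ℕ) [Decidable (s ≤ a)] :
    hook (MvPolynomial.monomial s 1) (dpMonomial a) =
      if s ≤ a then dpMonomial (a - s) else 0 := by
  have h1 : hook (MvPolynomial.monomial s 1) (dpMonomial a) =
      (∏ ρ, ((a ρ).factorial : ℂ))⁻¹ •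
        MvPolynomial.monomial (a - s) (∏ ρ, ((a ρ).descFactorial (s ρ) : ℂ)) := by
    have h2 : dpMonomial a = (∏ ρ, ((a ρ).factorial : ℂ))⁻¹ •
        MvPolynomial.basisMonomials ι ℂ a := by
      simp [dpMonomial, MvPolynomial.smul_monomial]
    have h3 : (MvPolynomial.monomial s 1 : MvPolynomial ι ℂ) =
        MvPolynomial.basisMonomials ι ℂ s := by simp
    rw [h2, h3, map_smul, hook, Module.Basis.constr_basis, Module.Basis.constr_basis]
  rw [h1, MvPolynomial.smul_monomial, smul_eq_mul]
  split_ifs with h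
  · rw [dpMonomial]
    congr 1
    rw [← Finset.prod_inv_distrib, ← Finset.prod_inv_distrib, ← Finset.prod_mul_distrib]
    refine Finset.prod_congr rfl fun ρ _ => ?_
    have h4 := Nat.factorial_mul_descFactorial (h ρ)
    rw [← h4, Finsupp.tsub_apply]
    have h5 : ((a ρ - s ρ).factorial : ℂ) ≠ 0 := by exact_mod_cast Nat.factorial_ne_zero _
    have h6 : ((a ρ).descFactorial (s ρ) : ℂ) ≠ 0 := by
      exact_mod_cast (Nat.descFactorial_pos.2 (h ρ)).ne'
    push_cast
    field_simp
  · obtain ⟨ρ, hρ⟩ : ∃ ρ, a ρ < s ρ := by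
      by_contra hc
      push Not at hc
      exact h hc
    have h7 : ∏ ρ, ((a ρ).descFactorial (s ρ) : ℂ) = 0 :=
      Finset.prod_eq_zero (Finset.mem_univ ρ) (by exact_mod_cast Nat.descFactorial_of_lt hρ)
    rw [h7, mul_zero, map_zero]

/-- The apolar ideal `F^⊥ = {Θ | Θ ⌟ F = 0}`, as a linear subspace of the Cox ring. -/
def apolar (F : MvPolynomial ι ℂ) : Submodule ℂ (MvPolynomial ι ℂ) :=
  LinearMap.ker (hook.flip F)

end Apolarity

section Secant

variable {V : Type*} [AddCommGroup V] [Module ℂ V]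

/-- The Zariski closure of a subset of `ℙ(V)`: the common zero set of all the homogeneous
polynomials on `V` (polynomials in linear forms on `V`) which vanish on the subset. -/
def zariskiClosure (A : Set (ℙ ℂ V)) : Set (ℙ ℂ V) :=
  {p | ∀ (d : ℕ) (P : MvPolynomial (Module.Dual ℂ V) ℂ), P.IsHomogeneous d →
    (∀ q ∈ A, MvPolynomial.eval (fun ξ => ξ q.rep) P = 0) →
      MvPolynomial.eval (fun ξ => ξ p.rep) P = 0}

/-- The `r`-th secant variety of `A ⊆ ℙ(V)`: the Zariski closure of the union of the projective
linear spans of `r` points of `A`. -/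
def secantVariety (A : Set (ℙ ℂ V)) (r : ℕ) : Set (ℙ ℂ V) :=
  zariskiClosure {p | ∃ q : Fin r → ℙ ℂ V, (∀ i, q i ∈ A) ∧
    p ∈ Projectivization.Subspace.span (Set.range q)}

end Secant

namespace FanData

variable {κ ι : Type*} [Fintype κ] [Fintype ι]

/-- Homogeneous coordinates of the points of the toric variety: the complement in `ι → ℂ` of the
zero locus of the irrelevant ideal, which is generated by the products `∏ ρ ∉ σ, α_ρ` for the
cones `σ` of the fan. -/
def homogeneousCoordinates (X : FanData κ ι) : Set (ι → ℂ) :=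
  {z | ∃ σ ∈ X.cones, ∀ ρ, ρ ∉ σ → z ρ ≠ 0}

/-- Evaluation of the sections of `L` at the point with homogeneous coordinates `z`. -/
def evalAt (X : FanData κ ι) (L : X.Pic) (z : ι → ℂ) : Module.Dual ℂ (X.sections L) :=
  (MvPolynomial.aeval z).toLinearMap ∘ₗ (X.sections L).subtype

/-- The image of the toric variety `X` in `ℙ(H⁰(X, L)^*)` under the (rational) map given by the
complete linear system of `L`; if `L` is very ample, this is `X` embedded by `L`. -/
def image (X : FanData κ ι) (L : X.Pic) : Set (ℙ ℂ (Module.Dual ℂ (X.sections L))) :=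
  {p | ∃ z ∈ X.homogeneousCoordinates, ∃ h : X.evalAt L z ≠ 0,
    p = Projectivization.mk ℂ (X.evalAt L z) h}

/-- The functional `Θ ↦ Θ ⌟ F` on `H⁰(X, L)` given by `F` in the piece of degree `L` of the dual
polynomial ring (for such `F` the polynomial `Θ ⌟ F` is constant). -/
def functional (X : FanData κ ι) (L : X.Pic) (F : MvPolynomial ι ℂ) :
    Module.Dual ℂ (X.sections L) :=
  (MvPolynomial.lcoeff ℂ 0) ∘ₗ hook.flip F ∘ₗ (X.sections L).subtype

/-- The border rank of `F` with respect to `X` in `ℙ(H⁰(X, L)^*)`: the least `r` such that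
`[F]` lies in the `r`-th secant variety. -/
def borderRank (X : FanData κ ι) (L : X.Pic) (F : MvPolynomial ι ℂ) : ℕ :=
  sInf {r | ∃ h : X.functional L F ≠ 0,
    Projectivization.mk ℂ (X.functional L F) h ∈ secantVariety (X.image L) r}

end FanData

end

/-! Lower bound. If `[F · G]` lies in the `r`-th secant variety, a valuation ring `B` of a field `K
⊇ ℂ` makes a generic combination of `r` evaluations, at points `z i` over `K`, specialize to the
functional of `F · G` (`exists_generic_specialization`). Consider the forms of degree `d` in `x₀,
x₁, x₂` with coefficients in the span of the monomials of degree `D` on `Y`, and those among them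
that vanish at the `z i`. Their leading monomials, by valuation and then by a term order, play the
role of the initial module of the limit of these forms. Three facts hold.

The leading monomials are stable under multiplication by the variables (`shift_mem_leads`). Their
complement is counted by the rank of the evaluation map, which is at most `r` and does not decrease
with `d` (`finrank_range_evaluation_le`). No leading monomial divides `F · G`, since contracting the
relation with `F · G` would give a sum with one strictly dominant term (`not_mem_leads`). The
condition `G^⊥_D = 0` says that all monomials of degree `D` divide `G`, so each of them is a full
label.

Take `d = a₁ + a₂`. If `a₀ ≥ d`, the `(a₁+1)(a₂+1)` divisors of `F` of degree `d` already give the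
bound for each label. Otherwise each leading monomial is a multiple of exactly one `x_i ^ (a_i+1)`.
A shadow inequality (`card_shift_ternary`) bounds the growth of each class from below, and
monotonicity of the rank bounds the total growth from above. Together with the trivial size bounds
this is a small linear program, solved in `card_compl_ternary`. Its optimum consists of all
multiples of `x₁ ^ (a₁+1)` and `x₂ ^ (a₂+1)` and none of `x₀ ^ (a₀+1)`, so at least `(a₁+1)(a₂+1)`
monomials per label remain.

Upper bound. Character sums over pairs of roots of unity of orders `a₁+1` and `a₂+1` express a curve
degenerating to `F` through `(a₁+1)(a₂+1)` points (`borderRank_projectivePlane_le`). -/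

/-! ### Counting sets of ternary monomials -/

theorem card_piAntidiag_fin_three (d : ℕ) :
    (Finset.piAntidiag (Finset.univ : Finset (Fin 3)) d).card = (d + 2).choose 2 := by
  have h := Finset.card_finsuppAntidiag_nat_eq_choose (s := (Finset.univ : Finset (Fin 3))) d
  rw [Finset.finsuppAntidiag, Finset.card_map, Finset.card_attach] at h
  rw [h]
  simp only [Finset.card_univ, Fintype.card_fin]
  rw [show 3 + d - 1 = d + 2 by omega]
  exact (Nat.choose_symm_add (a := d) (b := 2))

/-- Local LYM type inequality for shadows of sets of ternary monomials (with labels in `β`) which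
are divisible by a fixed monomial `s`. -/
theorem card_shift_ternary {β : Type*} {A A' : Finset ((Fin 3 → ℕ) × β)} (s : Fin 3 → ℕ) (e : ℕ)
    (hA : ∀ x ∈ A, s ≤ x.1 ∧ ∑ j, x.1 j = e + ∑ j, s j)
    (hA' : ∀ x ∈ A', s ≤ x.1 ∧ ∑ j, x.1 j = e + 1 + ∑ j, s j)
    (h : ∀ x ∈ A, ∀ j, (x.1 + Pi.single j 1, x.2) ∈ A') :
    (e + 3) * A.card ≤ (e + 1) * A'.card := by
  classical
  have key : ∀ (e : ℕ) (x : Fin 3 → ℕ), s ≤ x → ∑ j, x j = e + ∑ j, s j →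
      ∑ j, (x j - s j) = e := by
    intro e x hs hx
    rw [Finset.sum_tsub_distrib _ (fun j _ => hs j), hx, Nat.add_sub_cancel]
  -- Double count of pairs (monomial, variable), weighted by the exponent, in the quotient by `s`,
  -- that the variable has after multiplication. The weights over one `x ∈ A` sum to `e + 3`, those
  -- over one `x ∈ A'` to `e + 1`, and multiplication preserves them.
  have h1 : (e + 3) * A.card = ∑ p ∈ A ×ˢ (Finset.univ : Finset (Fin 3)),
      (p.1.1 p.2 - s p.2 + 1) := by
    rw [Finset.sum_product]
    have : ∀ x ∈ A, ∑ j : Fin 3, (x.1 j - s j + 1) = e + 3 := by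
      intro x hx
      rw [Finset.sum_add_distrib, key e x.1 (hA x hx).1 (hA x hx).2]
      simp
    rw [Finset.sum_congr rfl this, Finset.sum_const, smul_eq_mul, mul_comm]
  have h2 : (e + 1) * A'.card = ∑ p ∈ A' ×ˢ (Finset.univ : Finset (Fin 3)),
      (p.1.1 p.2 - s p.2) := by
    rw [Finset.sum_product]
    have : ∀ x ∈ A', ∑ j : Fin 3, (x.1 j - s j) = e + 1 := fun x hx =>
      key (e + 1) x.1 (hA' x hx).1 (hA' x hx).2
    rw [Finset.sum_congr rfl this, Finset.sum_const, smul_eq_mul, mul_comm]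
  let g : ((Fin 3 → ℕ) × β) × Fin 3 → ((Fin 3 → ℕ) × β) × Fin 3 :=
    fun p => ((p.1.1 + Pi.single p.2 1, p.1.2), p.2)
  have hg : Function.Injective g := by
    rintro ⟨⟨x, b⟩, j⟩ ⟨⟨y, c⟩, k⟩ hp
    simp only [g, Prod.mk.injEq] at hp
    obtain ⟨⟨h1, h2⟩, h3⟩ := hp
    subst h2 h3
    rw [add_left_inj] at h1
    rw [h1]
  have h3 : ∑ p ∈ A ×ˢ (Finset.univ : Finset (Fin 3)), (p.1.1 p.2 - s p.2 + 1) =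
      ∑ p ∈ (A ×ˢ (Finset.univ : Finset (Fin 3))).image g, (p.1.1 p.2 - s p.2) := by
    rw [Finset.sum_image hg.injOn]
    refine Finset.sum_congr rfl fun p hp => ?_
    have : s p.2 ≤ p.1.1 p.2 := (hA p.1 (Finset.mem_product.1 hp).1).1 p.2
    change _ = (p.1.1 + Pi.single p.2 1 : Fin 3 → ℕ) p.2 - s p.2
    rw [Pi.add_apply, Pi.single_eq_same]
    omega
  rw [h1, h2, h3]
  refine Finset.sum_le_sum_of_subset fun p hp => ?_
  obtain ⟨q, hq, rfl⟩ := Finset.mem_image.1 hp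
  exact Finset.mem_product.2 ⟨h q.1 (Finset.mem_product.1 hq).1 q.2, Finset.mem_univ _⟩

theorem card_le_ternary {β : Type*} [Fintype β] {A : Finset ((Fin 3 → ℕ) × β)} (s : Fin 3 → ℕ)
    (e : ℕ) (hA : ∀ x ∈ A, s ≤ x.1 ∧ ∑ j, x.1 j = e + ∑ j, s j) :
    A.card ≤ (e + 2).choose 2 * Fintype.card β := by
  classical
  rw [← card_piAntidiag_fin_three, ← Finset.card_univ, ← Finset.card_product]
  refine Finset.card_le_card_of_injOn (fun x => (x.1 - s, x.2)) ?_ ?_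
  · intro x hx
    have h := hA x hx
    simp only [Finset.coe_product, Set.mem_prod, Finset.mem_coe, Finset.mem_univ, and_true,
      Finset.mem_piAntidiag, implies_true, Pi.sub_apply]
    rw [Finset.sum_tsub_distrib _ (fun j _ => h.1 j), h.2, Nat.add_sub_cancel]
  · rintro ⟨x, b⟩ hx ⟨y, c⟩ hy hxy
    simp only [Prod.mk.injEq] at hxy
    obtain ⟨h1, h2⟩ := hxy
    have hx' := (hA _ hx).1
    have hy' := (hA _ hy).1
    rw [tsub_left_inj hx' hy'] at h1
    exact Prod.ext h1 h2

/-- If the set `A` of labelled ternary monomials of degree `a₁ + a₂` consists of multiples of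
`x₀ ^ (a₀ + 1)`, `x₁ ^ (a₁ + 1)`, `x₂ ^ (a₂ + 1)`, and its complement does not become smaller
in the next degree, then this complement has at least `(a₁ + 1) (a₂ + 1)` elements per label. -/
theorem card_compl_ternary {β : Type*} [Fintype β] {A A' : Finset ((Fin 3 → ℕ) × β)}
    {a₀ a₁ a₂ : ℕ} (h₀₁ : a₁ ≤ a₀) (h₁₂ : a₂ ≤ a₁) (h₀ : a₀ < a₁ + a₂)
    (hA : ∀ x ∈ A, ∑ j, x.1 j = a₁ + a₂ ∧ ¬ x.1 ≤ ![a₀, a₁, a₂])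
    (h : ∀ x ∈ A, ∀ j, (x.1 + Pi.single j 1, x.2) ∈ A')
    (hcard : A'.card + (a₁ + a₂ + 2).choose 2 * Fintype.card β ≤
      A.card + (a₁ + a₂ + 1 + 2).choose 2 * Fintype.card β) :
    (a₁ + 1) * (a₂ + 1) * Fintype.card β + A.card ≤
      (a₁ + a₂ + 2).choose 2 * Fintype.card β := by
  classical
  set a : Fin 3 → ℕ := ![a₀, a₁, a₂] with ha
  let s : Fin 3 → Fin 3 → ℕ := fun i => Pi.single i (a i + 1)
  have hs : ∀ i (x : Fin 3 → ℕ), s i ≤ x ↔ a i + 1 ≤ x i := by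
    intro i x
    constructor
    · intro h
      simpa [s] using h i
    · intro h j
      rcases eq_or_ne j i with rfl | hj
      · simpa [s] using h
      · simp [s, hj]
  have hsum : ∀ i, ∑ j, s i j = a i + 1 := fun i => by simp [s]
  let B : Fin 3 → Finset ((Fin 3 → ℕ) × β) := fun i => A.filter fun x => a i + 1 ≤ x.1 i
  let B' : Fin 3 → Finset ((Fin 3 → ℕ) × β) := fun i =>
    A'.filter fun x => a i + 1 ≤ x.1 i ∧ ∑ j, x.1 j = a₁ + a₂ + 1
  -- A common multiple of two of the powers `x_i ^ (a i + 1)` therefore has degree at least `a₁ + a₂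
  -- + 2`. This keeps the classes disjoint both in degree `a₁ + a₂` and one degree higher.
  have hpair : ∀ i j, i ≠ j → a₁ + a₂ ≤ a i + a j := by
    intro i j hij
    fin_cases i <;> fin_cases j <;> simp [ha] at hij ⊢ <;> omega
  have htwo : ∀ (x : Fin 3 → ℕ) i j, i ≠ j → x i + x j ≤ ∑ k, x k := by
    intro x i j hij
    rw [← Finset.sum_pair hij]
    exact Finset.sum_le_sum_of_subset (Finset.subset_univ _)
  have hB : ∑ i, (B i).card = A.card := by
    rw [← Finset.card_biUnion]
    · congr 1
      ext x
      simp only [B, Finset.mem_biUnion, Finset.mem_univ, true_and, Finset.mem_filter]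
      refine ⟨fun ⟨_, h, _⟩ => h, fun hx => ?_⟩
      obtain ⟨i, hi⟩ : ∃ i, a i < x.1 i := by
        by_contra hc
        push Not at hc
        exact (hA x hx).2 hc
      exact ⟨i, hx, hi⟩
    · intro i _ j _ hij
      refine Finset.disjoint_left.2 fun x hx hx' => ?_
      simp only [B, Finset.mem_filter] at hx hx'
      have h1 := hpair i j hij
      have h2 := htwo x.1 i j hij
      have h3 := (hA x hx.1).1
      omega
  have hB' : ∑ i, (B' i).card ≤ A'.card := by
    rw [← Finset.card_biUnion]
    · refine Finset.card_le_card fun x hx => ?_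
      simp only [B', Finset.mem_biUnion, Finset.mem_univ, true_and, Finset.mem_filter] at hx
      exact hx.choose_spec.1
    · intro i _ j _ hij
      refine Finset.disjoint_left.2 fun x hx hx' => ?_
      simp only [B', Finset.mem_filter] at hx hx'
      have h1 := hpair i j hij
      have h2 := htwo x.1 i j hij
      omega
  -- Here `a₀ < a₁ + a₂` is essential: with `a₁ ≤ a₀` it also forces `a₂ ≥ 1`. The difference `e i`
  -- is the degree left after dividing by `x_i ^ (a i + 1)`.
  have hlt : ∀ i, a i + 1 ≤ a₁ + a₂ := by
    intro i
    fin_cases i <;> simp [ha] <;> omega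
  choose e he using fun i => Nat.exists_eq_add_of_le' (hlt i)
  have hBmem : ∀ i, ∀ x ∈ B i, s i ≤ x.1 ∧ ∑ j, x.1 j = e i + ∑ j, s i j := by
    intro i x hx
    simp only [B, Finset.mem_filter] at hx
    rw [hs, hsum, ← he]
    exact ⟨hx.2, (hA x hx.1).1⟩
  have hcap : ∀ i, (B i).card ≤ (e i + 2).choose 2 * Fintype.card β := fun i =>
    card_le_ternary (s i) (e i) (hBmem i)
  have hgrow : ∀ i, (e i + 3) * (B i).card ≤ (e i + 1) * (B' i).card := by
    intro i
    refine card_shift_ternary (s i) (e i) (hBmem i) ?_ ?_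
    · intro x hx
      simp only [B', Finset.mem_filter] at hx
      rw [hs, hsum]
      have := he i
      exact ⟨hx.2.1, by omega⟩
    · intro x hx j
      simp only [B, Finset.mem_filter] at hx
      simp only [B', Finset.mem_filter]
      refine ⟨h x hx.1 j, ?_, ?_⟩
      · rw [Pi.add_apply]
        omega
      · simp [Finset.sum_add_distrib, (hA x hx.1).1]
  have hch : ∀ n : ℕ, ((n + 2).choose 2 : ℚ) = (n + 2) * (n + 1) / 2 := by
    intro n
    rw [Nat.cast_choose_two]
    push_cast
    ring
  generalize Fintype.card β = m at hcap hcard ⊢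
  -- In these normalized sizes the growth inequality says that class `i` gains at least `2 * q i`
  -- elements, with a constant independent of `i`.
  let q : Fin 3 → ℚ := fun i => (B i).card / (e i + 1)
  have hpos : ∀ i, (0 : ℚ) < e i + 1 := fun i => by positivity
  have hq : ∀ i, ((B i).card : ℚ) = (e i + 1) * q i := fun i => by
    have := (hpos i).ne'
    simp only [q]
    field_simp
  have hq1 : ∀ i, 2 * q i ≤ (B' i).card - (B i).card := by
    intro i
    have h1 : ((e i + 3) * (B i).card : ℚ) ≤ (e i + 1) * (B' i).card := by exact_mod_cast hgrow i
    rw [hq i] at h1 ⊢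
    refine le_of_mul_le_mul_left ?_ (hpos i)
    linarith
  have hq2 : ∀ i, q i ≤ (e i + 2) / 2 * m := by
    intro i
    have h1 : ((B i).card : ℚ) ≤ (e i + 2).choose 2 * m := by exact_mod_cast hcap i
    rw [hq i, hch] at h1
    refine le_of_mul_le_mul_left ?_ (hpos i)
    linarith
  have he0 : (a₁ + a₂ : ℚ) = e 0 + a₀ + 1 := by exact_mod_cast he 0
  have he1 : (a₂ : ℚ) = e 1 + 1 := by
    have : a₁ + a₂ = e 1 + (a₁ + 1) := he 1
    have : a₂ = e 1 + 1 := by omega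
    exact_mod_cast this
  have he2 : (a₁ : ℚ) = e 2 + 1 := by
    have : a₁ + a₂ = e 2 + (a₂ + 1) := he 2
    have : a₁ = e 2 + 1 := by omega
    exact_mod_cast this
  have h01 : (a₁ : ℚ) ≤ a₀ := by exact_mod_cast h₀₁
  have h12 : (a₂ : ℚ) ≤ a₁ := by exact_mod_cast h₁₂
  have hBq : (A.card : ℚ) = (B 0).card + (B 1).card + (B 2).card := by
    rw [← hB, Fin.sum_univ_three]
    push_cast
    ring
  have hBq' : ((B' 0).card + (B' 1).card + (B' 2).card : ℚ) ≤ A'.card := by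
    rw [Fin.sum_univ_three] at hB'
    exact_mod_cast hB'
  have hc : (A'.card + (a₁ + a₂ + 2 : ℕ).choose 2 * m : ℚ) ≤
      A.card + (a₁ + a₂ + 1 + 2 : ℕ).choose 2 * m := by
    exact_mod_cast hcard
  rw [hch, hch] at hc
  push_cast at hc
  have hgoal : ((a₁ + 1) * (a₂ + 1) * m + A.card : ℚ) ≤ (a₁ + a₂ + 2 : ℕ).choose 2 * m := by
    rw [hch]
    push_cast
    have hd : (A'.card : ℚ) - A.card ≤ (a₁ + a₂ + 2) * m := by linarith
    have hQ : 2 * (q 0 + q 1 + q 2) ≤ (a₁ + a₂ + 2) * m := by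
      have := hq1 0
      have := hq1 1
      have := hq1 2
      linarith
    -- Dual certificate of the linear program: the growth bound has multiplier `e 0 + 1`, the
    -- capacities of classes 1 and 2 have multipliers `e i - e 0`, nonnegative because `a₀` is the
    -- largest exponent. The two capacities exhaust the growth bound exactly, as `(e 1 + 2) + (e 2 +
    -- 2) = a₁ + a₂ + 2`.
    have k1 : 0 ≤ ((e 1 : ℚ) - e 0) * ((e 1 + 2) / 2 * m - q 1) :=
      mul_nonneg (by linarith) (sub_nonneg.2 (hq2 1))
    have k2 : 0 ≤ ((e 2 : ℚ) - e 0) * ((e 2 + 2) / 2 * m - q 2) :=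
      mul_nonneg (by linarith) (sub_nonneg.2 (hq2 2))
    have k3 := mul_le_mul_of_nonneg_left hQ (hpos 0).le
    have g0 := hq 0
    have g1 := hq 1
    have g2 := hq 2
    rw [hBq, g0, g1, g2]
    rw [he1, he2] at k3 ⊢
    linarith
  exact_mod_cast hgoal

/-! ### Leading indices over a valued field -/

section Leads

variable {K Γ J O : Type*} [Field K] [LinearOrderedCommGroupWithZero Γ] [LinearOrder O]

/-- The index `j` is leading for the vector `θ`: the coefficient `θ j` has the largest valuation,
and among the coefficients of largest valuation it has the largest key. -/
def IsLead (v : Valuation K Γ) (key : J → O) (θ : J → K) (j : J) : Prop :=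
  θ j ≠ 0 ∧ ∀ k, v (θ k) ≤ v (θ j) ∧ (key j < key k → v (θ k) < v (θ j))

/-- The leading indices of the nonzero vectors in a subspace. -/
def leads (v : Valuation K Γ) (key : J → O) (W : Submodule K (J → K)) : Set J :=
  {j | ∃ θ ∈ W, IsLead v key θ j}

variable {v : Valuation K Γ} {key : J → O}

theorem exists_isLead [Finite J] {θ : J → K} (hθ : θ ≠ 0) : ∃ j, IsLead v key θ j := by
  obtain ⟨i, hi⟩ := Function.ne_iff.1 hθ
  have : Nonempty J := ⟨i⟩
  obtain ⟨j, hj⟩ := Finite.exists_max fun k => toLex (v (θ k), key k)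
  have hle : ∀ k, v (θ k) ≤ v (θ j) ∧ (key j < key k → v (θ k) < v (θ j)) := by
    intro k
    have h := (Prod.Lex.toLex_le_toLex).1 (hj k)
    simp only at h
    rcases h with h | ⟨h1, h2⟩
    · exact ⟨h.le, fun _ => h⟩
    · exact ⟨h1.le, fun h3 => absurd h3 h2.not_gt⟩
  refine ⟨j, fun h0 => hi ?_, hle⟩
  have h1 := (hle i).1
  rw [h0, map_zero, le_zero_iff, map_eq_zero] at h1
  exact h1

theorem IsLead.smul {θ : J → K} {j : J} (h : IsLead v key θ j) {c : K} (hc : c ≠ 0) :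
    IsLead v key (c • θ) j := by
  have hv : 0 < v c := zero_lt_iff.2 ((Valuation.ne_zero_iff v).2 hc)
  refine ⟨mul_ne_zero hc h.1, fun k => ?_⟩
  simp only [Pi.smul_apply, smul_eq_mul, map_mul]
  exact ⟨mul_le_mul_right (h.2 k).1 _, fun hk => (mul_lt_mul_iff_right₀ hv).2 ((h.2 k).2 hk)⟩

/-- A nonzero vector has a leading index and does not vanish there, so restriction to the leading
coordinates is injective. -/
theorem finrank_le_ncard_leads [Finite J] (W : Submodule K (J → K)) :
    Module.finrank K W ≤ (leads v key W).ncard := by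
  classical
  have := Fintype.ofFinite J
  let f : W →ₗ[K] (leads v key W → K) :=
    LinearMap.funLeft K K Subtype.val ∘ₗ W.subtype
  have hf : Function.Injective f := by
    rw [← LinearMap.ker_eq_bot, LinearMap.ker_eq_bot']
    intro θ hθ
    by_contra hne
    obtain ⟨j, hj⟩ := exists_isLead (v := v) (key := key) (θ := (θ : J → K))
      (fun h => hne (Subtype.ext h))
    exact hj.1 (congrFun hθ ⟨j, θ, θ.2, hj⟩)
  have h := LinearMap.finrank_le_finrank_of_injective hf
  rwa [Module.finrank_fintype_fun_eq_card, ← Nat.card_eq_fintype_card] at h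

/-- Vectors with distinct leading indices are independent: in a relation, take the term whose
leading coefficient is largest for (valuation, key). At its index it strictly dominates all the
others; injectivity of the key excludes ties. -/
theorem ncard_leads_le_finrank [Finite J] (hkey : Function.Injective key)
    (W : Submodule K (J → K)) : (leads v key W).ncard ≤ Module.finrank K W := by
  classical
  have := Fintype.ofFinite J
  choose θ hθ using fun j : leads v key W => j.2
  have hli : LinearIndependent K fun j : leads v key W => (⟨θ j, (hθ j).1⟩ : W) := by
    rw [Fintype.linearIndependent_iff]
    intro c hc
    by_contra hne
    push Not at hne
    obtain ⟨i, hi⟩ := hne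
    have hsum : ∀ k : J, ∑ j, (c j • θ j) k = 0 := by
      intro k
      have h := congrArg (fun w : W => (w : J → K) k) hc
      simpa [Submodule.coe_sum] using h
    let S := {j : leads v key W // c j ≠ 0}
    have : Nonempty S := ⟨i, hi⟩
    obtain ⟨j, hj⟩ := Finite.exists_max fun k : S => toLex (v ((c k • θ k) k), key k)
    have hlead : ∀ k : S, IsLead v key (c k • θ k) k := fun k => (hθ k).2.smul k.2
    have hlt : v (∑ k ∈ Finset.univ.erase j.1, (c k • θ k) j) < v ((c j • θ j) j) := by
      refine v.map_sum_lt ((Valuation.ne_zero_iff v).2 (hlead j).1) fun k hk => ?_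
      have hkj := (Finset.mem_erase.1 hk).1
      by_cases hck : c k = 0
      · rw [hck, zero_smul, Pi.zero_apply, map_zero]
        exact zero_lt_iff.2 ((Valuation.ne_zero_iff v).2 (hlead j).1)
      · have h := (Prod.Lex.toLex_le_toLex).1 (hj ⟨k, hck⟩)
        simp only at h
        rcases h with h | ⟨h1, h2⟩
        · exact (((hlead ⟨k, hck⟩).2 j).1).trans_lt h
        · rw [← h1]
          refine ((hlead ⟨k, hck⟩).2 j).2 (lt_of_le_of_ne h2 fun h3 => hkj ?_)
          exact Subtype.ext (hkey h3)
    have h0 := hsum j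
    rw [← Finset.add_sum_erase _ _ (Finset.mem_univ j.1)] at h0
    have h1 := Valuation.map_add_eq_of_lt_left v hlt
    rw [h0, map_zero] at h1
    exact (hlead j).1 ((map_eq_zero v).1 h1.symm)
  have h := hli.fintype_card_le_finrank
  rwa [← Nat.card_eq_fintype_card] at h

end Leads

/-! ### Forms vanishing at points, and their leading monomials -/

/-- The exponents of the ternary monomials of degree `d`. -/
abbrev TernaryMonomial (d : ℕ) : Type := {μ : Fin 3 → ℕ // ∑ j, μ j = d}

namespace TernaryMonomial

noncomputable instance (d : ℕ) : Fintype (TernaryMonomial d) :=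
  Fintype.subtype (Finset.piAntidiag Finset.univ d) (by simp)

theorem card (d : ℕ) : Fintype.card (TernaryMonomial d) = (d + 2).choose 2 := by
  rw [← card_piAntidiag_fin_three]
  exact Fintype.subtype_card _ _

variable {d : ℕ} {β : Type*}

/-- Multiplication by the variable `j`, on labelled monomials. -/
def shift (j : Fin 3) (x : TernaryMonomial d × β) : TernaryMonomial (d + 1) × β :=
  (⟨x.1.1 + Pi.single j 1, by simp [Finset.sum_add_distrib, x.1.2]⟩, x.2)

theorem shift_injective (j : Fin 3) :
    Function.Injective (shift j : TernaryMonomial d × β → TernaryMonomial (d + 1) × β) := by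
  rintro ⟨⟨x, hx⟩, b⟩ ⟨⟨y, hy⟩, c⟩ h
  simp only [shift, Prod.mk.injEq, Subtype.mk.injEq, add_left_inj] at h
  obtain ⟨rfl, rfl⟩ := h
  rfl

/-- Forgetting the degree. -/
def val (x : TernaryMonomial d × β) : (Fin 3 → ℕ) × β := (x.1.1, x.2)

theorem val_injective : Function.Injective (val : TernaryMonomial d × β → (Fin 3 → ℕ) × β) := by
  rintro ⟨⟨x, hx⟩, b⟩ ⟨⟨y, hy⟩, c⟩ h
  simp only [val, Prod.mk.injEq] at h
  obtain ⟨rfl, rfl⟩ := h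
  rfl

variable [Fintype β]

/-- The lexicographic term order on labelled monomials. -/
noncomputable def key (x : TernaryMonomial d × β) : Lex (Fin 3 → ℕ) ×ₗ Fin (Fintype.card β) :=
  toLex (toLex x.1.1, Fintype.equivFin β x.2)

theorem key_injective : Function.Injective
    (key : TernaryMonomial d × β → Lex (Fin 3 → ℕ) ×ₗ Fin (Fintype.card β)) := by
  rintro ⟨⟨x, hx⟩, b⟩ ⟨⟨y, hy⟩, c⟩ h
  simp only [key, EmbeddingLike.apply_eq_iff_eq, Prod.mk.injEq] at h
  obtain ⟨rfl, rfl⟩ := h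
  rfl

theorem key_shift_lt (j : Fin 3) {x y : TernaryMonomial d × β} :
    key (shift j x) < key (shift j y) ↔ key x < key y := by
  simp only [key, shift, Prod.Lex.toLex_lt_toLex, toLex_add, add_lt_add_iff_right, add_left_inj]

section Evaluation

variable {K : Type*} [Field K] {r : ℕ} (z : Fin r → Fin 3 → K) (g : Fin r → β → K)

/-- Evaluation of labelled ternary forms of degree `d` at `r` points, at which the labels take the
values `g`. -/
noncomputable def evaluation (d : ℕ) : (TernaryMonomial d × β → K) →ₗ[K] (Fin r → K) :=
  Fintype.linearCombination K fun x i => (∏ j, z i j ^ x.1.1 j) * g i x.2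

theorem evaluation_apply (θ : TernaryMonomial d × β → K) (i : Fin r) :
    evaluation z g d θ i = ∑ x, θ x * ((∏ j, z i j ^ x.1.1 j) * g i x.2) := by
  simp [evaluation, Fintype.linearCombination_apply, Finset.sum_apply]

theorem evaluation_extend (j : Fin 3) (θ : TernaryMonomial d × β → K) (i : Fin r) :
    evaluation z g (d + 1) (Function.extend (shift j) θ 0) i =
      z i j * evaluation z g d θ i := by
  rw [evaluation_apply, evaluation_apply, Finset.mul_sum]
  symm
  refine Fintype.sum_of_injective (shift j) (shift_injective j) _ _ ?_ ?_
  · intro y hy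
    rw [Function.extend_apply' _ _ _ (by simpa using hy), Pi.zero_apply, zero_mul]
  · intro x
    rw [(shift_injective j).extend_apply]
    simp only [shift, Pi.add_apply, pow_add, Finset.prod_mul_distrib]
    have : ∏ k, z i k ^ (Pi.single j 1 : Fin 3 → ℕ) k = z i j := by
      rw [Finset.prod_eq_single j]
      · simp
      · intro k _ hk
        simp [hk]
      · simp
    rw [this]
    ring

/-- Multiplying forms by `x₀` rescales the values at the points by the nonzero numbers `z i 0`,
which is injective on value vectors. -/
theorem finrank_range_evaluation_le (hz : ∀ i, z i 0 ≠ 0) :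
    Module.finrank K (LinearMap.range (evaluation z g d)) ≤
      Module.finrank K (LinearMap.range (evaluation z g (d + 1))) := by
  let f : (Fin r → K) →ₗ[K] (Fin r → K) := LinearMap.pi fun i => z i 0 • LinearMap.proj i
  have hf : Function.Injective f := by
    intro x y hxy
    funext i
    exact mul_left_cancel₀ (hz i) (congrFun hxy i)
  rw [(Submodule.equivMapOfInjective f hf _).finrank_eq]
  refine Submodule.finrank_mono ?_
  rintro _ ⟨_, ⟨θ, rfl⟩, rfl⟩
  refine ⟨Function.extend (shift 0) θ 0, ?_⟩
  funext i
  rw [evaluation_extend]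
  rfl

variable {Γ : Type*} [LinearOrderedCommGroupWithZero Γ] (v : Valuation K Γ)

/-- Extension by zero along `shift j` is multiplication by `x_j`. It preserves vanishing at the
points, and the term order is compatible with it. -/
theorem shift_mem_leads (j : Fin 3) {x : TernaryMonomial d × β}
    (hx : x ∈ leads v key (LinearMap.ker (evaluation z g d))) :
    shift j x ∈ leads v key (LinearMap.ker (evaluation z g (d + 1))) := by
  obtain ⟨θ, hθ, h0, h⟩ := hx
  refine ⟨Function.extend (shift j) θ 0, ?_, ?_, ?_⟩
  · rw [LinearMap.mem_ker] at hθ ⊢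
    funext i
    rw [evaluation_extend, hθ, Pi.zero_apply, mul_zero]
  · rwa [(shift_injective j).extend_apply]
  · rw [(shift_injective j).extend_apply]
    intro y
    by_cases hy : ∃ x', shift j x' = y
    · obtain ⟨x', rfl⟩ := hy
      rw [(shift_injective j).extend_apply, key_shift_lt]
      exact h x'
    · rw [Function.extend_apply' _ _ _ hy, Pi.zero_apply, map_zero]
      exact ⟨zero_le, fun _ => zero_lt_iff.2 ((Valuation.ne_zero_iff v).2 h0)⟩

/-- The combination `c` of evaluations kills the kernel, yet it reduces to the coordinate at `x`. On
a vector with leading index `x` the term at `x` would strictly dominate a vanishing sum. Only the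
maximality of the valuation at `x` matters here, not the tie-break. -/
theorem not_mem_leads {x : TernaryMonomial d × β} (c : Fin r → K)
    (h1 : v (∑ i, c i * ((∏ j, z i j ^ x.1.1 j) * g i x.2)) = 1)
    (h2 : ∀ y : TernaryMonomial d × β, y ≠ x →
      v (∑ i, c i * ((∏ j, z i j ^ y.1.1 j) * g i y.2)) < 1) :
    x ∉ leads v key (LinearMap.ker (evaluation z g d)) := by
  classical
  rintro ⟨θ, hθ, h0, h⟩
  have hv : 0 < v (θ x) := zero_lt_iff.2 ((Valuation.ne_zero_iff v).2 h0)
  have hsum : ∑ y, θ y * ∑ i, c i * ((∏ j, z i j ^ y.1.1 j) * g i y.2) = 0 := by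
    have : ∑ i, c i * evaluation z g d θ i = 0 := by
      rw [LinearMap.mem_ker.1 hθ]
      simp
    rw [← this]
    simp_rw [evaluation_apply, Finset.mul_sum]
    rw [Finset.sum_comm]
    exact Finset.sum_congr rfl fun _ _ => Finset.sum_congr rfl fun _ _ => by ring
  rw [← Finset.add_sum_erase _ _ (Finset.mem_univ x)] at hsum
  have h3 : v (∑ y ∈ Finset.univ.erase x,
      θ y * ∑ i, c i * ((∏ j, z i j ^ y.1.1 j) * g i y.2)) <
      v (θ x * ∑ i, c i * ((∏ j, z i j ^ x.1.1 j) * g i x.2)) := by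
    rw [map_mul, h1, mul_one]
    refine v.map_sum_lt hv.ne' fun y hy => ?_
    rw [map_mul]
    calc v (θ y) * _ ≤ v (θ x) * v (∑ i, c i * ((∏ j, z i j ^ y.1.1 j) * g i y.2)) :=
          mul_le_mul_left (h y).1 _
      _ < v (θ x) * 1 := (mul_lt_mul_iff_right₀ hv).2 (h2 y (Finset.mem_erase.1 hy).1)
      _ = v (θ x) := mul_one _
  have h4 := Valuation.map_add_eq_of_lt_left v h3
  rw [hsum, map_zero, map_mul, h1, mul_one] at h4
  exact hv.ne h4

/-- Lower bound for the number of points whose evaluations specialize, with respect to a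
valuation, to the functional given by a ternary monomial. -/
theorem le_of_specialization (hz : ∀ i, z i 0 ≠ 0) {a₀ a₁ a₂ : ℕ} (h₀₁ : a₁ ≤ a₀) (h₁₂ : a₂ ≤ a₁)
    (H : ∀ x : TernaryMonomial (a₁ + a₂) × β, x.1.1 ≤ ![a₀, a₁, a₂] → ∃ c : Fin r → K,
      v (∑ i, c i * ((∏ j, z i j ^ x.1.1 j) * g i x.2)) = 1 ∧
      ∀ y : TernaryMonomial (a₁ + a₂) × β, y ≠ x →
        v (∑ i, c i * ((∏ j, z i j ^ y.1.1 j) * g i y.2)) < 1) :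
    (a₁ + 1) * (a₂ + 1) * Fintype.card β ≤ r := by
  classical
  set d := a₁ + a₂ with hd
  let A : ∀ d, Finset (TernaryMonomial d × β) := fun d =>
    (Set.toFinite (leads v key (LinearMap.ker (evaluation z g d)))).toFinset
  have hA : ∀ d, (A d).card = Module.finrank K (LinearMap.ker (evaluation z g d)) := by
    intro d
    rw [← Set.ncard_eq_toFinset_card]
    exact le_antisymm (ncard_leads_le_finrank key_injective _) (finrank_le_ncard_leads _)
  have hrank : ∀ d, Module.finrank K (LinearMap.range (evaluation z g d)) + (A d).card =
      (d + 2).choose 2 * Fintype.card β := by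
    intro d
    rw [hA, LinearMap.finrank_range_add_finrank_ker, Module.finrank_fintype_fun_eq_card,
      Fintype.card_prod, card]
  have hr : Module.finrank K (LinearMap.range (evaluation z g d)) ≤ r :=
    (Submodule.finrank_le _).trans (by simp)
  have hmem : ∀ x ∈ A d, ¬ x.1.1 ≤ ![a₀, a₁, a₂] := by
    intro x hx hle
    obtain ⟨c, h1, h2⟩ := H x hle
    exact not_mem_leads z g v c h1 h2 (by simpa [A] using hx)
  suffices hmain : (a₁ + 1) * (a₂ + 1) * Fintype.card β + (A d).card ≤
      (d + 2).choose 2 * Fintype.card β by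
    have := hrank d
    omega
  rcases le_or_gt (a₁ + a₂) a₀ with h₀ | h₀
  -- When `a₀ ≥ a₁ + a₂` the exponent of `x₀` is unconstrained in degree `d`: the exponents of `x₁`
  -- and `x₂` may be any `i ≤ a₁` and `j ≤ a₂`, and these monomials are never leading.
  · let f : (Fin (a₁ + 1) × Fin (a₂ + 1)) × β → TernaryMonomial d × β := fun x =>
      (⟨![d - (x.1.1 + x.1.2), x.1.1, x.1.2], by
        have := x.1.1.2
        have := x.1.2.2
        simp [Fin.sum_univ_three]
        omega⟩, x.2)
    have hf : Function.Injective f := by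
      rintro ⟨⟨i, j⟩, b⟩ ⟨⟨i', j'⟩, b'⟩ h
      simp only [f, Prod.mk.injEq, Subtype.mk.injEq] at h
      obtain ⟨h1, rfl⟩ := h
      have hi : (i : ℕ) = i' := congrFun h1 1
      have hj : (j : ℕ) = j' := congrFun h1 2
      rw [Fin.ext hi, Fin.ext hj]
    have hdisj : Disjoint (Finset.univ.image f) (A d) := by
      refine Finset.disjoint_left.2 fun x hx hx' => hmem x hx' ?_
      obtain ⟨⟨⟨i, j⟩, b⟩, -, rfl⟩ := Finset.mem_image.1 hx
      have := i.2
      have := j.2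
      intro k
      fin_cases k <;> simp [f] <;> omega
    have h1 := Finset.card_le_univ (Finset.univ.image f ∪ A d)
    rw [Finset.card_union_of_disjoint hdisj, Finset.card_image_of_injective _ hf,
      Finset.card_univ] at h1
    simpa [card] using h1
  · have hval : ∀ d, ((A d).image val).card = (A d).card := fun d =>
      Finset.card_image_of_injective _ val_injective
    have h1 := card_compl_ternary (A := (A d).image val) (A' := (A (d + 1)).image val) h₀₁ h₁₂ h₀
      ?_ ?_ ?_
    · rwa [hval] at h1
    · intro x hx
      obtain ⟨y, hy, rfl⟩ := Finset.mem_image.1 hx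
      exact ⟨y.1.2, hmem y hy⟩
    · intro x hx j
      obtain ⟨y, hy, rfl⟩ := Finset.mem_image.1 hx
      refine Finset.mem_image.2 ⟨shift j y, ?_, rfl⟩
      simp only [A, Set.Finite.mem_toFinset] at hy ⊢
      exact shift_mem_leads z g v j hy
    · rw [hval, hval, ← hd]
      have h2 := hrank d
      have h3 := hrank (d + 1)
      have h4 := finrank_range_evaluation_le z g hz (d := d)
      omega

end Evaluation

end TernaryMonomial

/-! ### Specialization of a generic point of the secant variety -/

/-- If `x` satisfies all the polynomial equations satisfied by `y`, then there is a valuation for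
which `x` is the specialization of `y`. -/
theorem exists_valuationSubring_specialization {k K Λ : Type*} [Field k] [Field K] [Algebra k K]
    (y : Λ → K) (x : Λ → k)
    (h : ∀ P : MvPolynomial Λ k, MvPolynomial.aeval y P = 0 → MvPolynomial.eval x P = 0) :
    ∃ B : ValuationSubring K, ∀ P : MvPolynomial Λ k, MvPolynomial.eval x P = 0 →
      B.valuation (MvPolynomial.aeval y P) < 1 := by
  let φ : MvPolynomial Λ k →+* K := (MvPolynomial.aeval y : MvPolynomial Λ k →ₐ[k] K)
  let I : Ideal φ.range := (RingHom.ker (MvPolynomial.eval x)).map φ.rangeRestrict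
  have hmem : ∀ a, a ∈ I ↔ ∃ P ∈ RingHom.ker (MvPolynomial.eval x), φ.rangeRestrict P = a := fun a =>
    Ideal.mem_map_iff_of_surjective _ φ.rangeRestrict_surjective
  -- If `1` were the value at `y` of some `P` vanishing at `x`, then `P - 1` would vanish at `y` but
  -- not at `x`. A proper ideal of a subring lies in the nonunits of some valuation ring.
  have hI : I ≠ ⊤ := by
    rw [Ne, Ideal.eq_top_iff_one, hmem]
    rintro ⟨P, hP, h1⟩
    have h2 : φ P = 1 := congrArg Subtype.val h1
    have h3 := h (P - 1) (by
      change φ (P - 1) = 0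
      rw [map_sub, h2, map_one, sub_self])
    rw [map_sub, (RingHom.mem_ker).1 hP, map_one, zero_sub, neg_eq_zero] at h3
    exact one_ne_zero h3
  obtain ⟨B, -, hB⟩ := Ideal.image_subset_nonunits_valuationSubring I hI
  refine ⟨B, fun P hP => ?_⟩
  have h1 := hB ⟨φ.rangeRestrict P, (hmem _).2 ⟨P, hP, rfl⟩, rfl⟩
  exact (ValuationSubring.mem_nonunits_iff B).1 h1

theorem eval_smul_of_isHomogeneous {R Λ : Type*} [CommSemiring R] {P : MvPolynomial Λ R} {d : ℕ}
    (hP : P.IsHomogeneous d) (s : R) (y : Λ → R) :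
    MvPolynomial.eval (s • y) P = s ^ d * MvPolynomial.eval y P := by
  rw [MvPolynomial.eval_eq, MvPolynomial.eval_eq, Finset.mul_sum]
  refine Finset.sum_congr rfl fun m hm => ?_
  have hd : ∑ i ∈ m.support, m i = d := by
    rw [← hP (MvPolynomial.mem_support_iff.1 hm), ← Finsupp.degree_apply]
    exact DFunLike.congr_fun (Finsupp.degree_eq_weight_one (R := ℕ)) m
  simp only [Pi.smul_apply, smul_eq_mul, mul_pow, Finset.prod_mul_distrib,
    Finset.prod_pow_eq_pow_sum, hd]
  ring

/-- If a polynomial vanishes on a set which is stable under scaling, then so do its homogeneous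
components. -/
theorem eval_homogeneousComponent_eq_zero {Λ : Type*} {P : MvPolynomial Λ ℂ} {y : Λ → ℂ}
    (h : ∀ s : ℂ, MvPolynomial.eval (s • y) P = 0) (d : ℕ) :
    MvPolynomial.eval y (MvPolynomial.homogeneousComponent d P) = 0 := by
  let Q : Polynomial ℂ := ∑ i ∈ Finset.range (P.totalDegree + 1),
    Polynomial.monomial i (MvPolynomial.eval y (MvPolynomial.homogeneousComponent i P))
  have hQ : Q = 0 := by
    refine Polynomial.funext fun s => ?_
    rw [Polynomial.eval_zero, ← h s]
    conv_rhs => rw [← MvPolynomial.sum_homogeneousComponent P]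
    rw [map_sum, Polynomial.eval_finsetSum]
    refine Finset.sum_congr rfl fun i _ => ?_
    rw [Polynomial.eval_monomial, mul_comm]
    exact (eval_smul_of_isHomogeneous (MvPolynomial.homogeneousComponent_isHomogeneous i P) s y).symm
  by_cases hd : d ∈ Finset.range (P.totalDegree + 1)
  · have h1 := congrArg (fun q => Polynomial.coeff q d) hQ
    simpa [Q, Polynomial.finsetSum_coeff, Polynomial.coeff_monomial, hd] using h1
  · rw [MvPolynomial.homogeneousComponent_eq_zero, map_zero]
    simpa using hd

/-- The coefficients and points are taken to be independent variables, so a polynomial relation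
between the generic coordinates holds for every choice of complex coefficients and points. The
coordinate vector of the monomial `f` then satisfies it too and is a specialization of the generic
one. -/
theorem exists_generic_specialization {σ Λ : Type*} [Fintype σ] (e : Λ → σ →₀ ℕ) (r : ℕ) (f : Λ)
    [DecidableEq Λ]
    (h : ∀ (d : ℕ) (P : MvPolynomial Λ ℂ), P.IsHomogeneous d →
      (∀ (c : Fin r → ℂ) (z : Fin r → σ → ℂ),
        MvPolynomial.eval (fun l => ∑ i, c i * ∏ ρ, z i ρ ^ e l ρ) P = 0) →
      MvPolynomial.eval (Pi.single f 1) P = 0) :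
    ∃ (B : ValuationSubring (FractionRing (MvPolynomial (Fin r × Option σ) ℂ)))
      (c : Fin r → FractionRing (MvPolynomial (Fin r × Option σ) ℂ))
      (z : Fin r → σ → FractionRing (MvPolynomial (Fin r × Option σ) ℂ)),
      (∀ i ρ, z i ρ ≠ 0) ∧ B.valuation (∑ i, c i * ∏ ρ, z i ρ ^ e f ρ) = 1 ∧
      ∀ l, l ≠ f → B.valuation (∑ i, c i * ∏ ρ, z i ρ ^ e l ρ) < 1 := by
  set T := MvPolynomial (Fin r × Option σ) ℂ with hT
  let yT : Λ → T := fun l => ∑ i, MvPolynomial.X (i, none) *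
    ∏ ρ, MvPolynomial.X (i, some ρ) ^ e l ρ
  let y : Λ → FractionRing T := fun l => algebraMap T (FractionRing T) (yT l)
  have hy : ∀ P : MvPolynomial Λ ℂ, MvPolynomial.aeval y P = 0 →
      MvPolynomial.eval (Pi.single f 1 : Λ → ℂ) P = 0 := by
    intro P hP
    have h1 : MvPolynomial.aeval yT P = 0 := by
      apply IsFractionRing.injective T (FractionRing T)
      rw [map_zero, ← hP]
      exact (MvPolynomial.aeval_algebraMap_apply (FractionRing T) yT P).symm
    have h2 : ∀ (c : Fin r → ℂ) (z : Fin r → σ → ℂ),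
        MvPolynomial.eval (fun l => ∑ i, c i * ∏ ρ, z i ρ ^ e l ρ) P = 0 := by
      intro c z
      let ev : T →ₐ[ℂ] ℂ :=
        MvPolynomial.aeval fun p : Fin r × Option σ => p.2.elim (c p.1) (z p.1)
      have h3 : (fun l => ∑ i, c i * ∏ ρ, z i ρ ^ e l ρ) = fun l => ev (yT l) := by
        funext l
        have hev : ∀ p, ev (MvPolynomial.X p) = p.2.elim (c p.1) (z p.1) := fun p =>
          MvPolynomial.aeval_X _ _
        simp only [yT, map_sum, map_mul, map_prod, map_pow, hev, Option.elim_none,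
          Option.elim_some]
      have h4 := congrArg ev h1
      rw [map_zero, ← AlgHom.comp_apply, MvPolynomial.comp_aeval] at h4
      rw [h3]
      exact h4
    -- The hypothesis covers homogeneous equations only. Scaling the coefficients `c` shows that the
    -- parametrized set is a cone, so each component of `P` vanishes on it.
    rw [← MvPolynomial.sum_homogeneousComponent P, map_sum]
    refine Finset.sum_eq_zero fun d _ => h d _
      (MvPolynomial.homogeneousComponent_isHomogeneous d P) fun c z => ?_
    refine eval_homogeneousComponent_eq_zero (fun s => ?_) d
    rw [← h2 (fun i => s * c i) z]
    congr 2
    funext l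
    simp [Finset.mul_sum, mul_assoc]
  obtain ⟨B, hB⟩ := exists_valuationSubring_specialization y (Pi.single f 1 : Λ → ℂ) hy
  have hyl : ∀ l, ∑ i, algebraMap T (FractionRing T) (MvPolynomial.X (i, none)) *
      ∏ ρ, algebraMap T (FractionRing T) (MvPolynomial.X (i, some ρ)) ^ e l ρ = y l := by
    intro l
    simp [y, yT]
  refine ⟨B, fun i => algebraMap T _ (MvPolynomial.X (i, none)),
    fun i ρ => algebraMap T _ (MvPolynomial.X (i, some ρ)), fun i ρ => ?_, ?_, fun l hl => ?_⟩
  · rw [Ne, FaithfulSMul.algebraMap_eq_zero_iff]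
    exact MvPolynomial.X_ne_zero _
  · rw [hyl]
    -- The coordinate at `f` specializes to `1`, so it differs from `1` by an element of valuation
    -- `< 1`.
    have h1 := hB (MvPolynomial.X f - 1) (by simp)
    rw [map_sub, map_one, MvPolynomial.aeval_X] at h1
    have h2 := B.valuation.map_one_add_of_lt h1
    rwa [add_sub_cancel] at h2
  · rw [hyl]
    have h1 := hB (MvPolynomial.X l) (by simp [hl])
    rwa [MvPolynomial.aeval_X] at h1

/-! ### Sections, evaluations and secant varieties in monomial coordinates -/

theorem coeff_zero_hook_dpMonomial {ι : Type*} [Fintype ι] (f : ι →₀ ℕ) (p : MvPolynomial ι ℂ) :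
    MvPolynomial.coeff 0 (hook p (dpMonomial f)) = MvPolynomial.coeff f p := by
  classical
  induction p using MvPolynomial.induction_on' with
  | monomial s a =>
    have h1 : (MvPolynomial.monomial s a : MvPolynomial ι ℂ) = a • MvPolynomial.monomial s 1 := by
      rw [MvPolynomial.smul_monomial, smul_eq_mul, mul_one]
    rw [h1, map_smul, LinearMap.smul_apply, hook_dpMonomial, MvPolynomial.coeff_smul,
      MvPolynomial.coeff_smul, MvPolynomial.coeff_monomial]
    congr 1
    by_cases hsf : s = f
    · subst hsf
      simp [dpMonomial]
    · rw [if_neg hsf]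
      split_ifs with hle
      · rw [dpMonomial, MvPolynomial.coeff_monomial, if_neg]
        intro h0
        exact hsf (le_antisymm hle (tsub_eq_zero_iff_le.1 h0))
      · simp
  | add p q hp hq => rw [map_add, LinearMap.add_apply, MvPolynomial.coeff_add, hp, hq,
      MvPolynomial.coeff_add]

theorem rename_dpMonomial_mul {ι ι' : Type*} [Fintype ι] [Fintype ι'] (a : ι →₀ ℕ) (b : ι' →₀ ℕ) :
    MvPolynomial.rename Sum.inl (dpMonomial a) * MvPolynomial.rename Sum.inr (dpMonomial b) =
      dpMonomial (Finsupp.sumElim a b) := by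
  rw [dpMonomial, dpMonomial, dpMonomial, MvPolynomial.rename_monomial,
    MvPolynomial.rename_monomial, MvPolynomial.monomial_mul, Fintype.prod_sum_type, mul_inv]
  congr 2
  ext x
  rcases x with x | x
  · rw [Finsupp.add_apply, Finsupp.mapDomain_apply Sum.inl_injective,
      Finsupp.mapDomain_of_notMem_range _ _ (by simp)]
    simp
  · rw [Finsupp.add_apply, Finsupp.mapDomain_apply Sum.inr_injective,
      Finsupp.mapDomain_of_notMem_range _ _ (by simp)]
    simp

theorem dpMonomial_ne_zero {ι : Type*} [Fintype ι] (a : ι →₀ ℕ) : dpMonomial a ≠ 0 := by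
  rw [dpMonomial, Ne, MvPolynomial.monomial_eq_zero, inv_eq_zero, Finset.prod_eq_zero_iff]
  rintro ⟨ρ, -, h⟩
  exact Nat.factorial_ne_zero _ (by exact_mod_cast h)

namespace FanData

variable {κ ι : Type*} [Fintype κ] (X : FanData κ ι)

theorem monomial_mem_sections {L : X.Pic} {c : ι →₀ ℕ} (hc : Finsupp.weight X.varDegree c = L)
    (a : ℂ) : MvPolynomial.monomial c a ∈ X.sections L :=
  MvPolynomial.isWeightedHomogeneous_monomial _ _ _ hc

/-- A point of the span of `r` points of the image of `X` is represented by a linear combination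
of evaluations. -/
theorem exists_rep_eq_sum {L : X.Pic} {r : ℕ} {q : Fin r → ℙ ℂ (Module.Dual ℂ (X.sections L))}
    (hq : ∀ i, q i ∈ X.image L) {p : ℙ ℂ (Module.Dual ℂ (X.sections L))}
    (hp : p ∈ Projectivization.Subspace.span (Set.range q)) :
    ∃ (c : Fin r → ℂ) (z : Fin r → ι → ℂ), p.rep = ∑ i, c i • X.evalAt L (z i) := by
  choose z hz h hqz using hq
  let W : Submodule ℂ (Module.Dual ℂ (X.sections L)) :=
    Submodule.span ℂ (Set.range fun i => X.evalAt L (z i))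
  have h1 : Projectivization.Subspace.span (Set.range q) ≤ W.projectivization := by
    rw [Projectivization.Subspace.span_le_subspace_iff]
    rintro _ ⟨i, rfl⟩
    rw [hqz i, SetLike.mem_coe, Submodule.mk_mem_projectivization_iff]
    exact Submodule.subset_span ⟨i, rfl⟩
  have h2 := h1 hp
  rw [← p.mk_rep, Submodule.mk_mem_projectivization_iff] at h2
  obtain ⟨c, hc⟩ := (Submodule.mem_span_range_iff_exists_fun ℂ).1 h2
  exact ⟨c, z, hc.symm⟩

theorem weight_varDegree (c : ι →₀ ℕ) :
    Finsupp.weight X.varDegree c = Submodule.Quotient.mk fun ρ => (c ρ : ℤ) := by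
  classical
  induction c using Finsupp.induction_linear with
  | zero =>
    rw [map_zero]
    symm
    rw [Submodule.Quotient.mk_eq_zero]
    exact ⟨0, by rw [map_zero]; rfl⟩
  | add c d hc hd =>
    rw [map_add, hc, hd, ← Submodule.Quotient.mk_add]
    rfl
  | single ρ n =>
    rw [Finsupp.weight_single, varDegree, ← Submodule.Quotient.mk_smul]
    congr 1
    funext k
    rcases eq_or_ne k ρ with rfl | hk
    · simp
    · simp [hk]

/-- The coefficient of a monomial, as a linear form on the sections of `L`. -/
noncomputable def coeffForm (L : X.Pic) (c : ι →₀ ℕ) : Module.Dual ℂ (X.sections L) :=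
  MvPolynomial.lcoeff ℂ c ∘ₗ (X.sections L).subtype

theorem coeffForm_ne_zero {L : X.Pic} {f : ι →₀ ℕ} (hf : Finsupp.weight X.varDegree f = L) :
    X.coeffForm L f ≠ 0 := by
  classical
  intro h
  have h1 := LinearMap.congr_fun h ⟨_, X.monomial_mem_sections hf 1⟩
  change MvPolynomial.coeff f (MvPolynomial.monomial f (1 : ℂ)) = 0 at h1
  rw [MvPolynomial.coeff_monomial, if_pos rfl] at h1
  exact one_ne_zero h1

/-- Sections of `L` as polynomials with restricted support. -/
theorem sections_eq_restrictSupport (L : X.Pic) : X.sections L =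
    MvPolynomial.restrictSupport ℂ {c : ι →₀ ℕ | Finsupp.weight X.varDegree c = L} :=
  MvPolynomial.weightedHomogeneousSubmodule_eq_finsupp_supported _ _ _

theorem weight_varDegree_eq_iff (c d : ι →₀ ℕ) :
    Finsupp.weight X.varDegree c = Finsupp.weight X.varDegree d ↔
      ∃ m : κ → ℤ, ∀ ρ, ∑ k, X.ray ρ k * m k = (c ρ : ℤ) - d ρ := by
  rw [weight_varDegree, weight_varDegree, Submodule.Quotient.eq, LinearMap.mem_range]
  refine exists_congr fun m => ?_
  rw [funext_iff]
  rfl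

theorem finrank_sections (L : X.Pic) [Fintype {c : ι →₀ ℕ | Finsupp.weight X.varDegree c = L}] :
    Module.finrank ℂ (X.sections L) =
      Fintype.card {c : ι →₀ ℕ | Finsupp.weight X.varDegree c = L} := by
  rw [sections_eq_restrictSupport]
  exact Module.finrank_eq_card_basis (MvPolynomial.basisRestrictSupport ℂ _)

theorem finiteDimensional_sections {L : X.Pic}
    (hL : {c : ι →₀ ℕ | Finsupp.weight X.varDegree c = L}.Finite) :
    FiniteDimensional ℂ (X.sections L) := by
  rw [sections_eq_restrictSupport]
  have := hL.to_subtype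
  exact Module.Finite.of_basis (MvPolynomial.basisRestrictSupport ℂ _)

variable [Fintype ι]

theorem weight_eq_of_dpMonomial_mem {L : X.Pic} {f : ι →₀ ℕ} (h : dpMonomial f ∈ X.sections L) :
    Finsupp.weight X.varDegree f = L := by
  classical
  refine h (d := f) ?_
  have := dpMonomial_ne_zero f
  rw [dpMonomial, Ne, MvPolynomial.monomial_eq_zero] at this
  rwa [dpMonomial, MvPolynomial.coeff_monomial, if_pos rfl]

theorem functional_dpMonomial (L : X.Pic) (f : ι →₀ ℕ) :
    X.functional L (dpMonomial f) = X.coeffForm L f := by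
  ext p
  exact coeff_zero_hook_dpMonomial f p

theorem evalAt_monomial {L : X.Pic} {c : ι →₀ ℕ} (hc : Finsupp.weight X.varDegree c = L)
    (z : ι → ℂ) : X.evalAt L z ⟨_, X.monomial_mem_sections hc 1⟩ = ∏ ρ, z ρ ^ c ρ := by
  change MvPolynomial.aeval z (MvPolynomial.monomial c (1 : ℂ)) = _
  rw [MvPolynomial.aeval_monomial, map_one, one_mul, Finsupp.prod_fintype _ _ fun _ => pow_zero _]

/-- Pulling `P` back along the values on monomials turns it into a homogeneous polynomial in linear
forms on the dual of the sections. Its vanishing on all combinations of `r` evaluations then passes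
to the Zariski closure, and in these coordinates the functional of the monomial `f` is a unit
vector. -/
theorem eval_eq_zero_of_mem_secantVariety [DecidableEq ι] {L : X.Pic} {r : ℕ} {f : ι →₀ ℕ}
    (hf : Finsupp.weight X.varDegree f = L) (h : X.functional L (dpMonomial f) ≠ 0)
    (hmem : Projectivization.mk ℂ (X.functional L (dpMonomial f)) h ∈
      secantVariety (X.image L) r)
    (d : ℕ) (P : MvPolynomial {c : ι →₀ ℕ // Finsupp.weight X.varDegree c = L} ℂ)
    (hP : P.IsHomogeneous d)
    (hvan : ∀ (c : Fin r → ℂ) (z : Fin r → ι → ℂ),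
      MvPolynomial.eval (fun l => ∑ i, c i * ∏ ρ, z i ρ ^ l.1 ρ) P = 0) :
    MvPolynomial.eval (Pi.single ⟨f, hf⟩ 1) P = 0 := by
  let ξ : {c : ι →₀ ℕ // Finsupp.weight X.varDegree c = L} →
      Module.Dual ℂ (Module.Dual ℂ (X.sections L)) := fun l =>
    Module.Dual.eval ℂ _ ⟨_, X.monomial_mem_sections l.2 1⟩
  have hev : ∀ w : Module.Dual ℂ (X.sections L),
      MvPolynomial.eval (fun η : Module.Dual ℂ (Module.Dual ℂ (X.sections L)) => η w)
        (MvPolynomial.rename ξ P) =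
      MvPolynomial.eval (fun l => w ⟨_, X.monomial_mem_sections l.2 1⟩) P := fun w =>
    MvPolynomial.eval_rename _ _ _
  have h1 := hmem d (MvPolynomial.rename ξ P) hP.rename_isHomogeneous ?_
  -- The chosen representative is only a unit multiple of the functional; homogeneity removes the
  -- factor.
  · rw [hev] at h1
    obtain ⟨u, hu⟩ := Projectivization.exists_smul_eq_mk_rep ℂ _ h
    have h2 : (fun l : {c : ι →₀ ℕ // Finsupp.weight X.varDegree c = L} =>
        (Projectivization.mk ℂ (X.functional L (dpMonomial f)) h).rep
          ⟨_, X.monomial_mem_sections l.2 1⟩) =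
        (u : ℂ) • (Pi.single ⟨f, hf⟩ 1 : {c : ι →₀ ℕ // Finsupp.weight X.varDegree c = L} → ℂ) := by
      funext l
      rw [← hu, functional_dpMonomial]
      change (u : ℂ) * MvPolynomial.coeff f (MvPolynomial.monomial l.1 (1 : ℂ)) = _
      rw [MvPolynomial.coeff_monomial, Pi.smul_apply, Pi.single_apply, smul_eq_mul]
      simp only [Subtype.ext_iff]
    rw [h2, eval_smul_of_isHomogeneous hP] at h1
    exact (mul_eq_zero.1 h1).resolve_left (pow_ne_zero _ u.ne_zero)
  · rintro p ⟨q, hq, hp⟩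
    obtain ⟨c, z, hcz⟩ := X.exists_rep_eq_sum hq hp
    rw [hev, hcz, ← hvan c z]
    congr 2
    funext l
    rw [LinearMap.sum_apply]
    exact Finset.sum_congr rfl fun i _ => by
      rw [LinearMap.smul_apply, X.evalAt_monomial l.2, smul_eq_mul]

/-- Lower bound for the number of points, when the Cox ring has three variables of the same
degree and a set of monomials of the same degree in the other variables. -/
theorem le_of_mem_secantVariety {L : X.Pic} {r : ℕ} {f : ι →₀ ℕ}
    (hf : Finsupp.weight X.varDegree f = L) (h : X.functional L (dpMonomial f) ≠ 0)
    (hmem : Projectivization.mk ℂ (X.functional L (dpMonomial f)) h ∈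
      secantVariety (X.image L) r)
    {τ : Fin 3 → ι} (hτ : Function.Injective τ) (hdeg : ∀ j, X.varDegree (τ j) = X.varDegree (τ 0))
    {β : Type*} [Fintype β] {b : β → ι →₀ ℕ} (hb : Function.Injective b)
    (hbτ : ∀ x j, b x (τ j) = 0) {D : X.Pic} (hbD : ∀ x, Finsupp.weight X.varDegree (b x) = D)
    (hbf : ∀ x, b x ≤ f) {a₀ a₁ a₂ : ℕ} (h₀₁ : a₁ ≤ a₀) (h₁₂ : a₂ ≤ a₁)
    (hfτ : ∀ j, f (τ j) = ![a₀, a₁, a₂] j) :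
    (a₁ + 1) * (a₂ + 1) * Fintype.card β ≤ r := by
  classical
  let E : (Fin 3 → ℕ) → β → ι →₀ ℕ := fun μ x => ∑ j, Finsupp.single (τ j) (μ j) + b x
  have hEτ : ∀ μ x k, E μ x (τ k) = μ k := by
    intro μ x k
    simp only [E, Finsupp.add_apply, hbτ, add_zero, Finsupp.finsetSum_apply, Finsupp.single_apply,
      hτ.eq_iff]
    simp
  have hEnot : ∀ μ x ρ, ρ ∉ Set.range τ → E μ x ρ = b x ρ := by
    intro μ x ρ hρ
    simp only [E, Finsupp.add_apply, Finsupp.finsetSum_apply]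
    rw [Finset.sum_eq_zero, zero_add]
    intro j _
    exact Finsupp.single_eq_of_ne fun h => hρ ⟨j, h.symm⟩
  have hEw : ∀ μ x, Finsupp.weight X.varDegree (E μ x) = (∑ j, μ j) • X.varDegree (τ 0) + D := by
    intro μ x
    rw [map_add, map_sum, hbD, Finset.sum_smul]
    congr 1
    exact Finset.sum_congr rfl fun j _ => by rw [Finsupp.weight_single, hdeg]
  have hEle : ∀ μ x, μ ≤ ![a₀, a₁, a₂] → E μ x ≤ f := by
    intro μ x hμ ρ
    by_cases hρ : ρ ∈ Set.range τ
    · obtain ⟨j, rfl⟩ := hρ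
      rw [hEτ, hfτ]
      exact hμ j
    · rw [hEnot _ _ _ hρ]
      exact hbf x ρ
  have hEinj : ∀ μ x μ' x', E μ x = E μ' x' → μ = μ' ∧ x = x' := by
    intro μ x μ' x' hE
    have hμ : μ = μ' := funext fun j => by rw [← hEτ μ x, hE, hEτ]
    subst hμ
    exact ⟨rfl, hb (add_left_cancel hE)⟩
  obtain ⟨B, C, z, hz, hB1, hB2⟩ := exists_generic_specialization
    (fun l : {c : ι →₀ ℕ // Finsupp.weight X.varDegree c = L} => l.1) r ⟨f, hf⟩
    (X.eval_eq_zero_of_mem_secantVariety hf h hmem)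
  have hsplit : ∀ (e : ι →₀ ℕ) μ x i, (C i * ∏ ρ, z i ρ ^ e ρ) *
      ((∏ j, z i (τ j) ^ μ j) * ∏ ρ, z i ρ ^ b x ρ) = C i * ∏ ρ, z i ρ ^ (e + E μ x) ρ := by
    intro e μ x i
    have h1 : ∏ ρ, z i ρ ^ (∑ j, Finsupp.single (τ j) (μ j)) ρ = ∏ j, z i (τ j) ^ μ j := by
      simp only [Finsupp.finsetSum_apply, ← Finset.prod_pow_eq_pow_sum]
      rw [Finset.prod_comm]
      refine Finset.prod_congr rfl fun j _ => ?_
      rw [Finset.prod_eq_single (τ j)]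
      · rw [Finsupp.single_eq_same]
      · intro ρ _ hρ
        rw [Finsupp.single_eq_of_ne hρ, pow_zero]
      · simp
    simp only [E, Finsupp.add_apply, pow_add, Finset.prod_mul_distrib, h1]
    ring
  -- Weighting the points by the monomial `f - E x` contracts the generic functional by it: the
  -- value on the monomial `E y` is the generic coordinate at `f - E x + E y`, a monomial of degree
  -- `L` that equals `f` only when `y = x`.
  refine TernaryMonomial.le_of_specialization (fun i j => z i (τ j))
    (fun i x => ∏ ρ, z i ρ ^ b x ρ) B.valuation (fun i => hz i _) h₀₁ h₁₂ fun x hx =>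
    ⟨fun i => C i * ∏ ρ, z i ρ ^ (f - E x.1.1 x.2) ρ, ?_, fun y hy => ?_⟩
  · simp only [hsplit, tsub_add_cancel_of_le (hEle _ _ hx)]
    exact hB1
  · simp only [hsplit]
    refine hB2 ⟨f - E x.1.1 x.2 + E y.1.1 y.2, ?_⟩ ?_
    · have h1 : Finsupp.weight X.varDegree (E y.1.1 y.2) =
          Finsupp.weight X.varDegree (E x.1.1 x.2) := by
        rw [hEw, hEw, y.1.2, x.1.2]
      rw [map_add, h1, ← map_add, tsub_add_cancel_of_le (hEle _ _ hx), hf]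
    · intro heq
      have h1 := congrArg Subtype.val heq
      simp only at h1
      conv_rhs at h1 => rw [← tsub_add_cancel_of_le (hEle _ x.2 hx)]
      obtain ⟨h2, h3⟩ := hEinj _ _ _ _ (add_left_cancel h1)
      exact hy (Prod.ext (Subtype.ext h2) h3)

end FanData

/-! ### Finiteness of linear systems and the lower bound for the border rank -/

namespace FanData

/-- By completeness the negative of the sum of all rays lies in a cone. The relation makes each
graded piece of the Cox ring finite-dimensional, see `finite_weight_eq`. -/
theorem exists_pos_relation {κ ι : Type*} [Fintype ι] (X : FanData κ ι)
    (h : ∀ v : κ → ℝ, ∃ σ ∈ X.cones, v ∈ X.cone σ) :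
    ∃ n : ι → ℝ, (∀ ρ, 0 < n ρ) ∧ ∀ k, ∑ ρ, n ρ * (X.ray ρ k : ℝ) = 0 := by
  obtain ⟨σ, -, c, hc, -, hv⟩ := h fun k => -∑ ρ, (X.ray ρ k : ℝ)
  refine ⟨fun ρ => 1 + c ρ, fun ρ => by linarith [hc ρ], fun k => ?_⟩
  simp_rw [add_mul, one_mul]
  rw [Finset.sum_add_distrib, ← hv k, add_neg_cancel]

theorem exists_pos_relation_prod {κ ι κ' ι' : Type*} [Fintype ι] [Fintype ι']
    (X : FanData κ ι) (Y : FanData κ' ι')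
    (hX : ∃ n : ι → ℝ, (∀ ρ, 0 < n ρ) ∧ ∀ k, ∑ ρ, n ρ * (X.ray ρ k : ℝ) = 0)
    (hY : ∃ n : ι' → ℝ, (∀ ρ, 0 < n ρ) ∧ ∀ k, ∑ ρ, n ρ * (Y.ray ρ k : ℝ) = 0) :
    ∃ n : ι ⊕ ι' → ℝ, (∀ ρ, 0 < n ρ) ∧ ∀ k, ∑ ρ, n ρ * ((X.prod Y).ray ρ k : ℝ) = 0 := by
  obtain ⟨n, hn, hnX⟩ := hX
  obtain ⟨n', hn', hnY⟩ := hY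
  refine ⟨Sum.elim n n', ?_, ?_⟩
  · rintro (ρ | ρ)
    · exact hn ρ
    · exact hn' ρ
  · rintro (k | k)
    · simpa [Fintype.sum_sum_type, prod] using hnX k
    · simpa [Fintype.sum_sum_type, prod] using hnY k

section Product

variable {κ ι κ' ι' : Type*} [Fintype κ] [Fintype κ'] (X : FanData κ ι) (Y : FanData κ' ι')

theorem weight_mapDomain_inl {c d : ι →₀ ℕ}
    (h : Finsupp.weight X.varDegree c = Finsupp.weight X.varDegree d) :
    Finsupp.weight (X.prod Y).varDegree (c.mapDomain Sum.inl) =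
      Finsupp.weight (X.prod Y).varDegree (d.mapDomain Sum.inl) := by
  rw [weight_varDegree_eq_iff] at h ⊢
  obtain ⟨m, hm⟩ := h
  refine ⟨Sum.elim m 0, ?_⟩
  rintro (ρ | ρ)
  · rw [Finsupp.mapDomain_apply Sum.inl_injective, Finsupp.mapDomain_apply Sum.inl_injective,
      ← hm]
    simp [prod]
  · rw [Finsupp.mapDomain_of_notMem_range _ _ (by simp),
      Finsupp.mapDomain_of_notMem_range _ _ (by simp)]
    simp [prod]

theorem weight_mapDomain_inr {c d : ι' →₀ ℕ}
    (h : Finsupp.weight Y.varDegree c = Finsupp.weight Y.varDegree d) :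
    Finsupp.weight (X.prod Y).varDegree (c.mapDomain Sum.inr) =
      Finsupp.weight (X.prod Y).varDegree (d.mapDomain Sum.inr) := by
  rw [weight_varDegree_eq_iff] at h ⊢
  obtain ⟨m, hm⟩ := h
  refine ⟨Sum.elim 0 m, ?_⟩
  rintro (ρ | ρ)
  · rw [Finsupp.mapDomain_of_notMem_range _ _ (by simp),
      Finsupp.mapDomain_of_notMem_range _ _ (by simp)]
    simp [prod]
  · rw [Finsupp.mapDomain_apply Sum.inr_injective, Finsupp.mapDomain_apply Sum.inr_injective,
      ← hm]
    simp [prod]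

end Product

variable {κ ι : Type*} [Fintype κ] [Fintype ι] (X : FanData κ ι)

/-- If the rays satisfy a linear relation with positive coefficients, then there are only finitely
many monomials of a given degree in the Cox ring. -/
theorem finite_weight_eq {n : ι → ℝ} (hn : ∀ ρ, 0 < n ρ)
    (hrel : ∀ k, ∑ ρ, n ρ * (X.ray ρ k : ℝ) = 0) (L : X.Pic) :
    {c : ι →₀ ℕ | Finsupp.weight X.varDegree c = L}.Finite := by
  rcases Set.eq_empty_or_nonempty {c : ι →₀ ℕ | Finsupp.weight X.varDegree c = L} with h | ⟨d, hd⟩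
  · rw [h]
    exact Set.finite_empty
  classical
  let S := ∑ ρ, n ρ * (d ρ : ℝ)
  refine (Set.finite_Icc 0 (Finsupp.equivFunOnFinite.symm fun ρ => ⌊S / n ρ⌋₊)).subset ?_
  intro c hc
  refine ⟨zero_le, ?_⟩
  obtain ⟨m, hm⟩ := (X.weight_varDegree_eq_iff c d).1 (hc.trans hd.symm)
  -- Exponents of equal degree differ by the divisor of a character, which pairs to zero with the
  -- relation `n`. So `∑ n ρ * c ρ` is constant on a degree, and positivity bounds every exponent.
  have h0 : ∑ ρ, n ρ * ((c ρ : ℝ) - d ρ) = 0 := by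
    have h1 : ∀ ρ, (c ρ : ℝ) - d ρ = ∑ k, (X.ray ρ k : ℝ) * m k := fun ρ => by
      exact_mod_cast (hm ρ).symm
    simp_rw [h1, Finset.mul_sum]
    rw [Finset.sum_comm]
    refine Finset.sum_eq_zero fun k _ => ?_
    rw [← zero_mul (m k : ℝ), ← hrel k, Finset.sum_mul]
    exact Finset.sum_congr rfl fun ρ _ => by ring
  have h2 : ∑ ρ, n ρ * (c ρ : ℝ) = S := by
    simp_rw [mul_sub] at h0
    rw [Finset.sum_sub_distrib] at h0
    exact sub_eq_zero.1 h0
  intro ρ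
  change c ρ ≤ ⌊S / n ρ⌋₊
  refine Nat.le_floor ?_
  rw [le_div_iff₀ (hn ρ), ← h2, mul_comm]
  exact Finset.single_le_sum (f := fun ρ => n ρ * (c ρ : ℝ))
    (fun ρ _ => mul_nonneg (hn ρ).le (Nat.cast_nonneg _)) (Finset.mem_univ ρ)

theorem exists_pos_relation_projectivePlane :
    ∃ n : Fin 3 → ℝ, (∀ ρ, 0 < n ρ) ∧ ∀ k, ∑ ρ, n ρ * (projectivePlane.ray ρ k : ℝ) = 0 := by
  refine ⟨1, fun _ => one_pos, fun k => ?_⟩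
  fin_cases k <;> simp [projectivePlane, Fin.sum_univ_three]

/-- Linear combinations of evaluations at points of the torus lie in the span of points of the
image of `X`. -/
theorem exists_mem_span_of_eq_sum (hX : X.cones.Nonempty) {L : X.Pic} {f : ι →₀ ℕ}
    (hf : Finsupp.weight X.varDegree f = L) {r : ℕ} (c : Fin r → ℂ) (z : Fin r → ι → ℂ)
    (hz : ∀ i ρ, z i ρ ≠ 0) {w : Module.Dual ℂ (X.sections L)} (hw : w ≠ 0)
    (hsum : w = ∑ i, c i • X.evalAt L (z i)) :
    ∃ q : Fin r → ℙ ℂ (Module.Dual ℂ (X.sections L)), (∀ i, q i ∈ X.image L) ∧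
      Projectivization.mk ℂ w hw ∈ Projectivization.Subspace.span (Set.range q) := by
  have hne : ∀ i, X.evalAt L (z i) ≠ 0 := by
    intro i h0
    have h1 := X.evalAt_monomial hf (z i)
    rw [h0, LinearMap.zero_apply] at h1
    exact Finset.prod_ne_zero_iff.2 (fun ρ _ => pow_ne_zero _ (hz i ρ)) h1.symm
  obtain ⟨σ, hσ⟩ := hX
  let q : Fin r → ℙ ℂ (Module.Dual ℂ (X.sections L)) := fun i => Projectivization.mk ℂ _ (hne i)
  refine ⟨q, fun i => ⟨z i, ⟨σ, hσ, fun ρ _ => hz i ρ⟩, hne i, rfl⟩, ?_⟩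
  rw [← Projectivization.Subspace.mem_submodule_iff, hsum]
  refine Submodule.sum_mem _ fun i _ => Submodule.smul_mem _ _ ?_
  rw [Projectivization.Subspace.mem_submodule_iff _ (hne i)]
  exact Projectivization.Subspace.subset_span _ ⟨i, rfl⟩

/-- The evaluations at points of the torus span the dual of the space of sections. -/
theorem span_evalAt_eq_top {L : X.Pic}
    (hL : {c : ι →₀ ℕ | Finsupp.weight X.varDegree c = L}.Finite) :
    Submodule.span ℂ (X.evalAt L '' {z | ∀ ρ, z ρ ≠ 0}) = ⊤ := by
  have := X.finiteDimensional_sections hL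
  rw [← Subspace.dualCoannihilator_dualAnnihilator_eq
    (W := Submodule.span ℂ (X.evalAt L '' {z | ∀ ρ, z ρ ≠ 0}))]
  suffices hbot : (Submodule.span ℂ
      (X.evalAt L '' {z | ∀ ρ, z ρ ≠ 0})).dualCoannihilator = ⊥ by
    rw [hbot]
    exact Submodule.dualAnnihilator_bot
  rw [eq_bot_iff]
  intro p hp
  rw [Submodule.mem_dualCoannihilator] at hp
  -- A section killed by all evaluations at torus points vanishes everywhere once multiplied by all
  -- the variables.
  have h1 : (p : MvPolynomial ι ℂ) * ∏ ρ, MvPolynomial.X ρ = 0 := by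
    refine MvPolynomial.funext fun z => ?_
    rw [map_mul, map_prod, map_zero]
    simp only [MvPolynomial.eval_X]
    by_cases hz : ∀ ρ, z ρ ≠ 0
    · have h2 : MvPolynomial.aeval z (p : MvPolynomial ι ℂ) = 0 :=
        hp _ (Submodule.subset_span ⟨z, hz, rfl⟩)
      rw [← MvPolynomial.coe_aeval_eq_eval]
      exact mul_eq_zero_of_left h2 _
    · push Not at hz
      obtain ⟨ρ, hρ⟩ := hz
      rw [Finset.prod_eq_zero (Finset.mem_univ ρ) hρ, mul_zero]
  rw [Submodule.mem_bot]
  refine Subtype.ext ((mul_eq_zero.1 h1).resolve_right ?_)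
  exact Finset.prod_ne_zero_iff.2 fun ρ _ => MvPolynomial.X_ne_zero ρ

/-- This makes the set defining the border rank nonempty, so that its `sInf` is a genuine minimum
and not the default value `0`. -/
theorem exists_mem_secantVariety (hX : X.cones.Nonempty) {L : X.Pic}
    (hL : {c : ι →₀ ℕ | Finsupp.weight X.varDegree c = L}.Finite) {f : ι →₀ ℕ}
    (hf : Finsupp.weight X.varDegree f = L) :
    ∃ r, ∃ h : X.functional L (dpMonomial f) ≠ 0,
      Projectivization.mk ℂ (X.functional L (dpMonomial f)) h ∈
        secantVariety (X.image L) r := by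
  have hne : X.functional L (dpMonomial f) ≠ 0 := by
    rw [functional_dpMonomial]
    exact X.coeffForm_ne_zero hf
  have hmem : X.functional L (dpMonomial f) ∈
      Submodule.span ℂ (X.evalAt L '' {z | ∀ ρ, z ρ ≠ 0}) := by
    rw [X.span_evalAt_eq_top hL]
    trivial
  obtain ⟨r, c, w, hw⟩ := Submodule.mem_span_set'.1 hmem
  choose z hz hzw using fun i => (w i).2
  refine ⟨r, hne, fun d P _ hvan => hvan _ ?_⟩
  refine X.exists_mem_span_of_eq_sum hX hf c z hz hne ?_
  rw [← hw]
  exact Finset.sum_congr rfl fun i _ => by rw [hzw]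

theorem projectivePlane_cones_nonempty : projectivePlane.cones.Nonempty := by
  refine ⟨∅, ?_⟩
  change (∅ : Set (Fin 3)) ≠ Set.univ
  exact Set.empty_ne_univ

theorem projectivePlane_varDegree (j : Fin 3) :
    projectivePlane.varDegree j = projectivePlane.varDegree 0 := by
  have h : ∀ j, projectivePlane.varDegree j =
      Finsupp.weight projectivePlane.varDegree (Finsupp.single j 1) := fun j => by
    rw [Finsupp.weight_single, one_smul]
  rw [h, h, weight_varDegree_eq_iff]
  refine ⟨![if j = 1 then 1 else 0, if j = 2 then 1 else 0], fun ρ => ?_⟩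
  fin_cases j <;> fin_cases ρ <;> simp [projectivePlane, Fin.sum_univ_two]

theorem prod_projectivePlane_varDegree {κ' ι' : Type*} [Fintype κ'] [Fintype ι']
    (Y : FanData κ' ι') (j : Fin 3) :
    (projectivePlane.prod Y).varDegree (Sum.inl j) =
      (projectivePlane.prod Y).varDegree (Sum.inl 0) := by
  have h := weight_mapDomain_inl projectivePlane Y (c := Finsupp.single j 1)
    (d := Finsupp.single 0 1) (by
      rw [Finsupp.weight_single, Finsupp.weight_single, projectivePlane_varDegree])
  simpa only [Finsupp.mapDomain_single, Finsupp.weight_single, one_smul] using h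

/-- A monomial not dividing the one with exponent `b` annihilates it, so it would be a nonzero
element of the apolar ideal in degree `D`. -/
theorem le_of_apolar_inf_sections_eq_bot {b : ι →₀ ℕ} {D : X.Pic}
    (h : apolar (dpMonomial b) ⊓ X.sections D = ⊥) {c : ι →₀ ℕ}
    (hc : Finsupp.weight X.varDegree c = D) : c ≤ b := by
  classical
  by_contra hcb
  have h1 : (MvPolynomial.monomial c 1 : MvPolynomial ι ℂ) ∈
      apolar (dpMonomial b) ⊓ X.sections D := by
    refine ⟨?_, X.monomial_mem_sections hc 1⟩
    rw [SetLike.mem_coe, apolar, LinearMap.mem_ker, LinearMap.flip_apply, hook_dpMonomial,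
      if_neg hcb]
  rw [h, Submodule.mem_bot, MvPolynomial.monomial_eq_zero] at h1
  exact one_ne_zero h1

/-- The border rank is attained. -/
theorem mem_secantVariety_borderRank (hX : X.cones.Nonempty) {L : X.Pic}
    (hL : {c : ι →₀ ℕ | Finsupp.weight X.varDegree c = L}.Finite) {f : ι →₀ ℕ}
    (hf : Finsupp.weight X.varDegree f = L) :
    ∃ h : X.functional L (dpMonomial f) ≠ 0,
      Projectivization.mk ℂ (X.functional L (dpMonomial f)) h ∈
        secantVariety (X.image L) (X.borderRank L (dpMonomial f)) :=
  Nat.sInf_mem (X.exists_mem_secantVariety hX hL hf)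

theorem le_borderRank_prod {κ' ι' : Type*} [Fintype κ'] [Fintype ι'] {Y : FanData κ' ι'}
    (hY : Y.IsSmoothProjective) {a₀ a₁ a₂ : ℕ} (h₀₁ : a₁ ≤ a₀) (h₁₂ : a₂ ≤ a₁) {b : ι' →₀ ℕ}
    {D : Y.Pic} (hD : apolar (dpMonomial b) ⊓ Y.sections D = ⊥) {L : (projectivePlane.prod Y).Pic}
    (hL : dpMonomial (Finsupp.sumElim (Finsupp.equivFunOnFinite.symm ![a₀, a₁, a₂]) b) ∈
      (projectivePlane.prod Y).sections L) :
    (a₁ + 1) * (a₂ + 1) * Module.finrank ℂ (Y.sections D) ≤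
      (projectivePlane.prod Y).borderRank L
        (dpMonomial (Finsupp.sumElim (Finsupp.equivFunOnFinite.symm ![a₀, a₁, a₂]) b)) := by
  have hYrel := Y.exists_pos_relation hY.complete
  have hf := (projectivePlane.prod Y).weight_eq_of_dpMonomial_mem hL
  have hcones : (projectivePlane.prod Y).cones.Nonempty := by
    obtain ⟨σ, hσ, -⟩ := hY.complete 0
    refine ⟨Sum.inr '' σ, ?_, ?_⟩
    · change Sum.inl ⁻¹' (Sum.inr '' σ) ≠ Set.univ
      rw [Ne, Set.eq_univ_iff_forall]
      intro h
      simpa using h 0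
    · rwa [Set.preimage_image_eq _ Sum.inr_injective]
  have hfin : {c : _ →₀ ℕ | Finsupp.weight (projectivePlane.prod Y).varDegree c = L}.Finite := by
    obtain ⟨n, hn, hrel⟩ :=
      exists_pos_relation_prod projectivePlane Y exists_pos_relation_projectivePlane hYrel
    exact finite_weight_eq _ hn hrel L
  obtain ⟨h, hmem⟩ := mem_secantVariety_borderRank _ hcones hfin hf
  obtain ⟨n, hn, hrel⟩ := hYrel
  have := (Y.finite_weight_eq hn hrel D).fintype
  rw [Y.finrank_sections D]
  -- A monomial `b₀` of degree `D`, if there is one, supplies the class of `D` in the Picard group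
  -- of the product, as the degree of its image there.
  rcases isEmpty_or_nonempty {c : ι' →₀ ℕ | Finsupp.weight Y.varDegree c = D} with hβ | ⟨⟨b₀, hb₀⟩⟩
  · rw [Fintype.card_eq_zero, mul_zero]
    exact Nat.zero_le _
  refine le_of_mem_secantVariety _ hf h hmem (τ := Sum.inl) Sum.inl_injective
    (fun j => prod_projectivePlane_varDegree Y j)
    (b := fun x : {c : ι' →₀ ℕ | Finsupp.weight Y.varDegree c = D} => x.1.mapDomain Sum.inr)
    ((Finsupp.mapDomain_injective Sum.inr_injective).comp Subtype.val_injective)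
    (fun x j => Finsupp.mapDomain_of_notMem_range _ _ (by simp))
    (fun x => weight_mapDomain_inr projectivePlane Y (x.2.trans (Eq.symm hb₀)))
    (fun x ρ => ?_) h₀₁ h₁₂ fun j => rfl
  rcases ρ with ρ | ρ
  · rw [Finsupp.mapDomain_of_notMem_range _ _ (by simp)]
    exact Nat.zero_le _
  · rw [Finsupp.mapDomain_apply Sum.inr_injective]
    exact Y.le_of_apolar_inf_sections_eq_bot hD x.2 ρ

theorem le_borderRank_projectivePlane {a₀ a₁ a₂ : ℕ} (h₀₁ : a₁ ≤ a₀) (h₁₂ : a₂ ≤ a₁)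
    {L : projectivePlane.Pic}
    (hL : dpMonomial (Finsupp.equivFunOnFinite.symm ![a₀, a₁, a₂]) ∈ projectivePlane.sections L) :
    (a₁ + 1) * (a₂ + 1) ≤ projectivePlane.borderRank L
      (dpMonomial (Finsupp.equivFunOnFinite.symm ![a₀, a₁, a₂])) := by
  have hf := projectivePlane.weight_eq_of_dpMonomial_mem hL
  have hfin : {c : _ →₀ ℕ | Finsupp.weight projectivePlane.varDegree c = L}.Finite := by
    obtain ⟨n, hn, hrel⟩ := exists_pos_relation_projectivePlane
    exact finite_weight_eq _ hn hrel L
  obtain ⟨h, hmem⟩ := mem_secantVariety_borderRank _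
    projectivePlane_cones_nonempty hfin hf
  have h1 := le_of_mem_secantVariety _ hf h hmem (τ := id) Function.injective_id
    projectivePlane_varDegree (b := fun _ : Unit => 0) (Function.injective_of_subsingleton _)
    (fun _ _ => rfl) (fun _ => map_zero _) (fun _ => zero_le) h₀₁ h₁₂ fun j => rfl
  simpa using h1

end FanData

/-! ### The upper bound, by a curve of combinations of points -/

/-- The limit at `t = 0` of a polynomial curve lies in the Zariski closure. -/
theorem mem_zariskiClosure_of_curve {V : Type*} [AddCommGroup V] [Module ℂ V] {A : Set (ℙ ℂ V)}
    {φ : ℂ → V} (hφ : ∀ ξ : Module.Dual ℂ V, ∃ p : Polynomial ℂ, ∀ t, ξ (φ t) = p.eval t)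
    (hA : ∀ t, t ≠ 0 → ∀ h : φ t ≠ 0, Projectivization.mk ℂ (φ t) h ∈ A) (h0 : φ 0 ≠ 0) :
    Projectivization.mk ℂ (φ 0) h0 ∈ zariskiClosure A := by
  intro d P hP hvan
  choose p hp using hφ
  have hrep : ∀ (v : V) (hv : v ≠ 0),
      MvPolynomial.eval (fun ξ : Module.Dual ℂ V => ξ (Projectivization.mk ℂ v hv).rep) P = 0 ↔
        MvPolynomial.eval (fun ξ : Module.Dual ℂ V => ξ v) P = 0 := by
    intro v hv
    obtain ⟨u, hu⟩ := Projectivization.exists_smul_eq_mk_rep ℂ v hv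
    have h1 : (fun ξ : Module.Dual ℂ V => ξ (Projectivization.mk ℂ v hv).rep) =
        (u : ℂ) • fun ξ : Module.Dual ℂ V => ξ v := by
      funext ξ
      rw [← hu]
      exact map_smul ξ (u : ℂ) v
    rw [h1, eval_smul_of_isHomogeneous hP, mul_eq_zero]
    exact or_iff_right (pow_ne_zero _ u.ne_zero)
  rw [hrep]
  let Q : Polynomial ℂ := MvPolynomial.aeval p P
  have hQ : ∀ t, MvPolynomial.eval (fun ξ : Module.Dual ℂ V => ξ (φ t)) P = Q.eval t := by
    intro t
    have h1 := DFunLike.congr_fun (MvPolynomial.comp_aeval (R := ℂ) p (Polynomial.aeval t)) P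
    rw [AlgHom.comp_apply, Polynomial.coe_aeval_eq_eval] at h1
    simp only [Q, hp]
    rw [h1]
    rfl
  obtain ⟨ξ, hξ⟩ : ∃ ξ : Module.Dual ℂ V, ξ (φ 0) ≠ 0 := by
    by_contra hc
    push Not at hc
    exact h0 ((Module.forall_dual_apply_eq_zero_iff ℂ _).1 hc)
  -- The factor `X` takes care of `t = 0`, where nothing is known yet, and `p ξ` of the parameters
  -- where `φ t = 0` defines no point. Both are nonzero polynomials, so `Q` vanishes identically.
  have hzero : Polynomial.X * (p ξ * Q) = 0 := by
    refine Polynomial.funext fun t => ?_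
    rw [Polynomial.eval_mul, Polynomial.eval_mul, Polynomial.eval_X, Polynomial.eval_zero,
      ← hp, ← hQ]
    by_cases ht : t = 0
    · rw [ht, zero_mul]
    · by_cases hφt : φ t = 0
      · rw [hφt, map_zero, zero_mul, mul_zero]
      · rw [(hrep _ hφt).1 (hvan _ (hA t ht hφt)), mul_zero, mul_zero]
  have hpξ : p ξ ≠ 0 := by
    intro h
    apply hξ
    rw [hp, h, Polynomial.eval_zero]
  rw [hQ, (mul_eq_zero.1 ((mul_eq_zero.1 hzero).resolve_left Polynomial.X_ne_zero)).resolve_left hpξ,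
    Polynomial.eval_zero]

theorem IsPrimitiveRoot.sum_pow_mul_pow {ζ : ℂ} {n : ℕ} (hζ : IsPrimitiveRoot ζ n) (m : ℕ) :
    ∑ j : Fin n, (ζ ^ m) ^ (j : ℕ) = if n ∣ m then (n : ℂ) else 0 := by
  rw [Fin.sum_univ_eq_sum_range (fun j => (ζ ^ m) ^ j) n]
  split_ifs with h
  · rw [(hζ.pow_eq_one_iff_dvd m).2 h]
    simp
  · have h1 : ζ ^ m ≠ 1 := fun h2 => h ((hζ.pow_eq_one_iff_dvd m).1 h2)
    rw [geom_sum_eq h1, ← pow_mul, mul_comm, pow_mul, hζ.pow_eq_one, one_pow, sub_self, zero_div]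

namespace FanData

theorem evalAt_eq_sum {κ ι : Type*} [Fintype κ] [Fintype ι] (X : FanData κ ι) {L : X.Pic}
    [Fintype {c : ι →₀ ℕ // Finsupp.weight X.varDegree c = L}] (z : ι → ℂ) :
    X.evalAt L z = ∑ c : {c : ι →₀ ℕ // Finsupp.weight X.varDegree c = L},
      (∏ ρ, z ρ ^ c.1 ρ) • X.coeffForm L c.1 := by
  classical
  ext p
  rw [LinearMap.sum_apply]
  change MvPolynomial.aeval z (p : MvPolynomial ι ℂ) =
    ∑ c : {c : ι →₀ ℕ // Finsupp.weight X.varDegree c = L},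
      (∏ ρ, z ρ ^ c.1 ρ) * MvPolynomial.coeff c.1 (p : MvPolynomial ι ℂ)
  have hev : MvPolynomial.aeval z (p : MvPolynomial ι ℂ) = MvPolynomial.eval z p.1 := by
    rw [← MvPolynomial.coe_aeval_eq_eval]
    rfl
  rw [hev, MvPolynomial.eval_eq']
  have hsub : ∀ c ∈ (p : MvPolynomial ι ℂ).support, Finsupp.weight X.varDegree c = L := fun c hc =>
    p.2 (MvPolynomial.mem_support_iff.1 hc)
  rw [← Finset.sum_attach]
  refine Finset.sum_of_injOn (fun c => ⟨c.1, hsub c.1 c.2⟩) ?_ (by simp) ?_ ?_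
  · intro c _ d _ h
    exact Subtype.ext (Subtype.mk.inj h)
  · intro c _ hc
    rw [MvPolynomial.notMem_support_iff.1, mul_zero]
    intro h
    exact hc ⟨⟨c.1, h⟩, by simp, rfl⟩
  · intro c _
    rw [mul_comm]

/-- The monomials of `ℙ²` of a given degree are determined by two of the exponents. -/
theorem projectivePlane_eq_of_weight_eq {c d : Fin 3 →₀ ℕ}
    (h : Finsupp.weight projectivePlane.varDegree c = Finsupp.weight projectivePlane.varDegree d)
    (h1 : c 1 = d 1) (h2 : c 2 = d 2) : c = d := by
  obtain ⟨m, hm⟩ := (weight_varDegree_eq_iff _ _ _).1 h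
  have e0 := hm 0
  have e1 := hm 1
  have e2 := hm 2
  simp [projectivePlane, Fin.sum_univ_two] at e0 e1 e2
  ext j
  fin_cases j
  · change c 0 = d 0
    omega
  · exact h1
  · exact h2

/-- The points `[1 : t ζ ^ i : t η ^ j]`, with `ζ` and `η` primitive roots of unity of orders `a 1 +
1` and `a 2 + 1`, are combined by a character sum. It keeps only the coordinates with exponents
congruent to `a 1` and `a 2` modulo these orders. Among them `F` has the lowest order in `t`, so it
is the limit. -/
theorem borderRank_projectivePlane_le {a : Fin 3 → ℕ} {L : projectivePlane.Pic}
    (hL : dpMonomial (Finsupp.equivFunOnFinite.symm a) ∈ projectivePlane.sections L) :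
    projectivePlane.borderRank L (dpMonomial (Finsupp.equivFunOnFinite.symm a)) ≤
      (a 1 + 1) * (a 2 + 1) := by
  classical
  set f : Fin 3 →₀ ℕ := Finsupp.equivFunOnFinite.symm a with hfa
  have hf := projectivePlane.weight_eq_of_dpMonomial_mem hL
  have hfin : {c : Fin 3 →₀ ℕ | Finsupp.weight projectivePlane.varDegree c = L}.Finite := by
    obtain ⟨n, hn, hrel⟩ := exists_pos_relation_projectivePlane
    exact finite_weight_eq _ hn hrel L
  have hΛ : Fintype {c : Fin 3 →₀ ℕ // Finsupp.weight projectivePlane.varDegree c = L} :=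
    hfin.fintype
  let good : (Fin 3 →₀ ℕ) → Prop := fun c => a 1 + 1 ∣ c 1 + 1 ∧ a 2 + 1 ∣ c 2 + 1
  have hgood : ∀ c, good c → a 1 ≤ c 1 ∧ a 2 ≤ c 2 := by
    rintro c ⟨h1, h2⟩
    have := Nat.le_of_dvd (Nat.succ_pos _) h1
    have := Nat.le_of_dvd (Nat.succ_pos _) h2
    omega
  -- The value of the character sum, written so that it also makes sense at `t = 0`. By `hgood` the
  -- subtraction in the exponent is not truncated where it is used, and the exponent is zero only
  -- for `c = f`.
  let φ : ℂ → Module.Dual ℂ (projectivePlane.sections L) := fun t =>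
    ∑ c : {c : Fin 3 →₀ ℕ // Finsupp.weight projectivePlane.varDegree c = L},
      (if good c.1 then t ^ (c.1 1 + c.1 2 - (a 1 + a 2)) else 0) • projectivePlane.coeffForm L c.1
  have hφ0 : φ 0 = projectivePlane.functional L (dpMonomial f) := by
    rw [functional_dpMonomial]
    simp only [φ]
    rw [Finset.sum_eq_single ⟨f, hf⟩]
    · have : good f := ⟨dvd_rfl, dvd_rfl⟩
      rw [if_pos this]
      have h1 : f 1 = a 1 := rfl
      have h2 : f 2 = a 2 := rfl
      rw [h1, h2, Nat.sub_self, pow_zero, one_smul]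
    · intro c _ hc
      split_ifs with hg
      · rw [zero_pow, zero_smul]
        intro h0
        have h1 := hgood _ hg
        refine hc (Subtype.ext (projectivePlane_eq_of_weight_eq (c.2.trans hf.symm) ?_ ?_))
        · change c.1 1 = a 1
          omega
        · change c.1 2 = a 2
          omega
      · rw [zero_smul]
    · simp
  have hne : projectivePlane.functional L (dpMonomial f) ≠ 0 := by
    rw [functional_dpMonomial]
    exact projectivePlane.coeffForm_ne_zero hf
  refine Nat.sInf_le ⟨hne, ?_⟩
  have hne0 : φ 0 ≠ 0 := by rwa [hφ0]
  suffices hmain : Projectivization.mk ℂ (φ 0) hne0 ∈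
      secantVariety (projectivePlane.image L) ((a 1 + 1) * (a 2 + 1)) by
    convert hmain using 2
    exact hφ0.symm
  refine mem_zariskiClosure_of_curve ?_ ?_ hne0
  · intro ξ
    refine ⟨∑ c : {c : Fin 3 →₀ ℕ // Finsupp.weight projectivePlane.varDegree c = L},
      (if good c.1 then Polynomial.X ^ (c.1 1 + c.1 2 - (a 1 + a 2)) else 0) *
        Polynomial.C (ξ (projectivePlane.coeffForm L c.1)), fun t => ?_⟩
    rw [map_sum, Polynomial.eval_finsetSum]
    refine Finset.sum_congr rfl fun c _ => ?_
    rw [map_smul, smul_eq_mul, Polynomial.eval_mul, Polynomial.eval_C]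
    split_ifs <;> simp
  · intro t ht hφt
    have hζ : ∀ n : ℕ, IsPrimitiveRoot (Complex.exp (2 * Real.pi * Complex.I / (n + 1 : ℕ))) (n + 1) :=
      fun n => Complex.isPrimitiveRoot_exp (n + 1) (Nat.succ_ne_zero n)
    set ζ : ℕ → ℂ := fun n => Complex.exp (2 * Real.pi * Complex.I / (n + 1 : ℕ))
    have hζ0 : ∀ n, ζ n ≠ 0 := fun n => Complex.exp_ne_zero _
    let e := (finProdFinEquiv (m := a 1 + 1) (n := a 2 + 1)).symm
    let z : Fin (a 1 + 1) × Fin (a 2 + 1) → Fin 3 → ℂ := fun p =>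
      ![1, t * ζ (a 1) ^ (p.1 : ℕ), t * ζ (a 2) ^ (p.2 : ℕ)]
    let N : ℂ := ((a 1 + 1 : ℕ) : ℂ) * ((a 2 + 1 : ℕ) : ℂ)
    have hN : N ≠ 0 :=
      mul_ne_zero (Nat.cast_ne_zero.2 (Nat.succ_ne_zero _)) (Nat.cast_ne_zero.2 (Nat.succ_ne_zero _))
    -- The extra powers of the roots of unity shift the exponents by one, so that orthogonality
    -- selects `a 1 + 1 ∣ c 1 + 1` and `a 2 + 1 ∣ c 2 + 1`. The scalar normalizes the coefficient of
    -- `F` to `1`.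
    let C : Fin (a 1 + 1) × Fin (a 2 + 1) → ℂ := fun p =>
      (N * t ^ (a 1 + a 2))⁻¹ * (ζ (a 1) ^ (p.1 : ℕ) * ζ (a 2) ^ (p.2 : ℕ))
    refine projectivePlane.exists_mem_span_of_eq_sum projectivePlane_cones_nonempty hf
      (fun i => C (e i)) (fun i => z (e i)) ?_ hφt ?_
    · intro i ρ
      fin_cases ρ
      · exact one_ne_zero
      · exact mul_ne_zero ht (pow_ne_zero _ (hζ0 _))
      · exact mul_ne_zero ht (pow_ne_zero _ (hζ0 _))
    · rw [Equiv.sum_comp e fun p => C p • projectivePlane.evalAt L (z p)]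
      simp_rw [evalAt_eq_sum, Finset.smul_sum, smul_smul]
      rw [Finset.sum_comm]
      refine Finset.sum_congr rfl fun c _ => ?_
      rw [← Finset.sum_smul]
      congr 1
      have hterm : ∀ p, C p * ∏ ρ, z p ρ ^ c.1 ρ = (N * t ^ (a 1 + a 2))⁻¹ * t ^ (c.1 1 + c.1 2) *
          ((ζ (a 1) ^ (c.1 1 + 1)) ^ (p.1 : ℕ) * (ζ (a 2) ^ (c.1 2 + 1)) ^ (p.2 : ℕ)) := by
        intro p
        rw [Fin.prod_univ_three]
        simp only [C, z, Matrix.cons_val_zero, Matrix.cons_val_one, Matrix.cons_val]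
        ring
      simp_rw [hterm]
      rw [← Finset.mul_sum, Fintype.sum_prod_type]
      dsimp only
      rw [← Finset.sum_mul_sum, (hζ (a 1)).sum_pow_mul_pow, (hζ (a 2)).sum_pow_mul_pow]
      by_cases hg : good c.1
      · have h1 := hgood _ hg
        rw [if_pos hg, if_pos hg.1, if_pos hg.2]
        change _ = _ * N
        have h2 : t ^ (c.1 1 + c.1 2) = t ^ (c.1 1 + c.1 2 - (a 1 + a 2)) * t ^ (a 1 + a 2) := by
          rw [← pow_add]
          congr 1
          omega
        rw [h2]
        have h3 : t ^ (a 1 + a 2) ≠ 0 := pow_ne_zero _ ht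
        field_simp
      · rw [if_neg hg]
        rcases not_and_or.1 hg with h | h
        · rw [if_neg h, zero_mul, mul_zero]
        · rw [if_neg h, mul_zero, mul_zero]

end FanData

theorem mainTheorem7 (a₀ a₁ a₂ : ℕ) (h₀₁ : a₁ ≤ a₀) (h₁₂ : a₂ ≤ a₁)
    (F : MvPolynomial (Fin 3) ℂ)
    (hF : F = dpMonomial (Finsupp.equivFunOnFinite.symm ![a₀, a₁, a₂])) :
    (∀ (κ ι : Type*) [Fintype κ] [Fintype ι] (Y : FanData κ ι), Y.IsSmoothProjective →
      ∀ (b : ι →₀ ℕ) (G : MvPolynomial ι ℂ), G = dpMonomial b →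
      ∀ D : Y.Pic, apolar G ⊓ Y.sections D = ⊥ →
      ∀ L : (FanData.projectivePlane.prod Y).Pic,
        MvPolynomial.rename Sum.inl F * MvPolynomial.rename Sum.inr G ∈
          (FanData.projectivePlane.prod Y).sections L →
        (a₁ + 1) * (a₂ + 1) * Module.finrank ℂ (Y.sections D) ≤
          (FanData.projectivePlane.prod Y).borderRank L
            (MvPolynomial.rename Sum.inl F * MvPolynomial.rename Sum.inr G)) ∧
    (∀ L : FanData.projectivePlane.Pic, F ∈ FanData.projectivePlane.sections L →
      FanData.projectivePlane.borderRank L F = (a₁ + 1) * (a₂ + 1)) := by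
  subst hF
  refine ⟨?_, fun L hL => le_antisymm (FanData.borderRank_projectivePlane_le hL)
    (FanData.le_borderRank_projectivePlane h₀₁ h₁₂ hL)⟩
  intro κ ι _ _ Y hY b G hG D hD L hL
  subst hG
  rw [rename_dpMonomial_mul] at hL ⊢
  exact FanData.le_borderRank_prod hY h₀₁ h₁₂ hD hL
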